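/- A \emph{prefix tree} is a structure $\mathcal T=(T,R_1,R_2,R_3,\dots;r)$, where each $R_n$ is an $n$-ary relation on $T$ and $r\in T$, such that $R_1=\{r\}$ and, whenever $R_n(a_1,\dots,a_n)$ and $1\le i\le n$, also $R_i(a_1,\dots,a_i)$. It is \emph{injective} if, whenever $R_{n+1}(a_1,\dots,a_n,c)$ and $R_{k+1}(b_1,\dots,b_k,c)$ with $n,k\ge 0$, then $n=k$ and $a_i=b_i$ for all $i$. It has \emph{unbounded depth} if $R_n\neq\emptyset$ for every $n\ge 1$. A countably infinite structure is \emph{computable} if its domain is a computable subset of $\mathbb N$ and its relations, functions and constants are computable uniformly in their indices. A structure with domain $\mathbb B=\{0,1\}^{<\omega}$, whose relation, function and constant symbols are each indexed by all positive integers or by a finite initial segment of them, is \emph{fully P-TIME} if (i) there are a single Turing machine and a single polynomial $P$ such that the machine answers correctly, within $P(n)$ steps, every input of length $n$ over the alphabet $\{0,1,a,b,c,d\}$ of one of the following forms: $a^i x_1 d x_2 d\cdots d x_m$ (does the $i$-th relation, which is $m$-ary, hold of $(x_1,\dots,x_m)$?), $b^j x_1 d x_2 d\cdots d x_m$ (what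 is the value of the $j$-th function, which is $m$-ary, at $(x_1,\dots,x_m)$?), $c^k w$ (is the $k$-th constant equal to $w$?), where $x_1,\dots,x_m,w\in\mathbb B$; and (ii) the functions that take the index of a relation or of a function to its arity (both written in unary) are polynomial-time computable. \textbf{Theorem.} The class of injective prefix trees of unbounded depth is P-TIME robust: every computable injective prefix tree of unbounded depth is isomorphic to a fully P-TIME structure (with domain $\{0,1\}^{<\omega}$), where $R_n$ is the relation of index $n$ and $r$ is the constant of index $1$. -/

import Mathlib

/-! ### Numbered signatures, computable structures, fully P-TIME structures -/

namespace PTimeAlgebra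

open FirstOrder.Language.Structure
open scoped FirstOrder

/-- `S` is the set of all positive natural numbers or a finite initial segment of it. -/
def IsIndexSet (S : Set ℕ) : Prop :=
  S = {i | 1 ≤ i} ∨ ∃ m : ℕ, S = Set.Icc 1 m

/-- A numbering of a signature: relation symbols, function symbols (of positive arity) and
constant symbols (which Mathlib represents as `0`-ary function symbols) are each listed, without
repetition, by all positive natural numbers or by an initial segment of them. -/
class SymbolNumbering (L : FirstOrder.Language.{0, 0}) where
  relIdx : ∀ {n : ℕ}, L.Relations n → ℕ
  funIdx : ∀ {n : ℕ}, L.Functions (n + 1) → ℕ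
  constIdx : L.Functions 0 → ℕ
  relIdx_inj : Function.Injective (fun R : (Σ n, L.Relations n) => relIdx R.2)
  relIdx_range : IsIndexSet (Set.range (fun R : (Σ n, L.Relations n) => relIdx R.2))
  funIdx_inj : Function.Injective (fun F : (Σ n, L.Functions (n + 1)) => funIdx F.2)
  funIdx_range : IsIndexSet (Set.range (fun F : (Σ n, L.Functions (n + 1)) => funIdx F.2))
  constIdx_inj : Function.Injective constIdx
  constIdx_range : IsIndexSet (Set.range constIdx)

open SymbolNumbering

/-- A structure whose domain is a set `D` of natural numbers is computable if `D` is computable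
and all relations, functions and constants are computable uniformly in their indices. -/
structure IsComputable (L : FirstOrder.Language.{0, 0}) [SymbolNumbering L] (D : Set ℕ) [L.Structure D] :
    Prop where
  domain : ComputablePred (fun m : ℕ => m ∈ D)
  relations : ComputablePred (fun p : ℕ × List ℕ =>
    ∃ (n : ℕ) (R : L.Relations n) (x : Fin n → D),
      p.1 = relIdx R ∧ p.2 = List.ofFn (fun i => (x i : ℕ)) ∧ RelMap R x)
  functions : ∃ f : ℕ × List ℕ →. ℕ, Partrec f ∧
    ∀ (n : ℕ) (F : L.Functions (n + 1)) (x : Fin (n + 1) → D),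
      ((funMap F x : D) : ℕ) ∈ f (funIdx F, List.ofFn (fun i => (x i : ℕ)))
  constants : ∃ f : ℕ → ℕ, Computable f ∧
    ∀ C : L.Functions 0, f (constIdx C) = ((funMap C default : D) : ℕ)

/-- The set `{0,1}^{<ω}` of all finite binary strings. -/
abbrev BinString : Type := List Bool

/-- The input alphabet `{0, 1, a, b, c, d}`. -/
inductive Letter : Type
  | zero | one | a | b | c | d
  deriving DecidableEq

/-- A binary string as a word over the input alphabet. -/
def word (w : BinString) : List Letter :=
  w.map (fun t => if t then Letter.one else Letter.zero)

/-- A tuple of binary strings, separated by the letter `d`. -/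
def tupleWord {n : ℕ} (x : Fin n → BinString) : List Letter :=
  [Letter.d].intercalate (List.ofFn (fun i => word (x i)))

/-- The questions one may ask about a structure with domain `{0,1}^{<ω}`: does a relation hold
of a tuple, what is the value of a function at a tuple, is a constant equal to a given element. -/
inductive Query (L : FirstOrder.Language.{0, 0}) : Type
  | rel {n : ℕ} (R : L.Relations n) (x : Fin n → BinString)
  | func {n : ℕ} (F : L.Functions (n + 1)) (x : Fin (n + 1) → BinString)
  | const (C : L.Functions 0) (w : BinString)

/-- The input word of a query: the index of the symbol, in unary, by a number of letters
`a` (relations), `b` (functions) or `c` (constants), followed by the arguments. -/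
def Query.input {L : FirstOrder.Language.{0, 0}} [SymbolNumbering L] : Query L → List Letter
  | .rel R x => List.replicate (relIdx R) Letter.a ++ tupleWord x
  | .func F x => List.replicate (funIdx F) Letter.b ++ tupleWord x
  | .const C w => List.replicate (constIdx C) Letter.c ++ word w

open Classical in
/-- The correct answer to a query: a truth value, written as a single bit, for relations and
constants, and the value of the function for functions. -/
noncomputable def Query.answer {L : FirstOrder.Language.{0, 0}} [L.Structure BinString] :
    Query L → BinString
  | .rel R x => [decide (RelMap R x)]
  | .func F x => funMap F x
  | .const C w => [decide (w = funMap C default)]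

/-- A structure with domain `{0,1}^{<ω}` is fully P-TIME if one Turing machine answers all
queries within one polynomial bound in the length of the input word, and the functions that take
the index of a relation or function symbol to its arity are polynomial-time computable (all
numbers in unary, as in the input words). -/
structure IsFullyPTime (L : FirstOrder.Language.{0, 0}) [SymbolNumbering L] [L.Structure BinString] :
    Prop where
  uniform : Nonempty (Turing.TM2ComputableInPolyTime
    (Query.input : Query L → List Letter) (id : BinString → List Bool) Query.answer)
  relArity : Nonempty (Turing.TM2ComputableInPolyTime
    (fun R : (Σ n, L.Relations n) => List.replicate (relIdx R.2) ())
    (fun n : ℕ => List.replicate n ()) (fun R => R.1))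
  funArity : Nonempty (Turing.TM2ComputableInPolyTime
    (fun F : (Σ n, L.Functions (n + 1)) => List.replicate (funIdx F.2) ())
    (fun n : ℕ => List.replicate n ()) (fun F => F.1 + 1))

/-- `M` is isomorphic to a fully P-TIME structure. -/
def FullyPTimePresentable (L : FirstOrder.Language.{0, 0}) [SymbolNumbering L] (M : Type) [L.Structure M] :
    Prop :=
  ∃ _ : L.Structure BinString, IsFullyPTime L ∧ Nonempty (M ≃[L] BinString)

/-- A class `𝔎` of structures is P-TIME robust if every computable (countably infinite) member
of it is fully P-TIME presentable. -/
def PTimeRobust (L : FirstOrder.Language.{0, 0}) [SymbolNumbering L]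
    (𝔎 : ∀ (M : Type) [L.Structure M], Prop) : Prop :=
  ∀ (D : Set ℕ) [L.Structure D], D.Infinite → IsComputable L D → 𝔎 D →
    FullyPTimePresentable L D

end PTimeAlgebra

/-! ### Prefix trees -/

namespace PrefixTree

open FirstOrder.Language.Structure

/-- For every `n`, one relation symbol `R_{n+1}` of arity `n + 1`; none of arity `0`. -/
inductive Rel : ℕ → Type
  | path (n : ℕ) : Rel (n + 1)

/-- One constant symbol, `r`. -/
inductive Fun : ℕ → Type
  | root : Fun 0

/-- The signature `(R_1, R_2, R_3, …; r)`, `R_n` being `n`-ary. -/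
def sig : FirstOrder.Language.{0, 0} := ⟨Fun, Rel⟩

/-- `R_n` has index `n`, and `r` has index `1`. -/
instance : PTimeAlgebra.SymbolNumbering sig where
  relIdx {n} _ := n
  funIdx _ := 1
  constIdx _ := 1
  relIdx_inj := by
    rintro ⟨_, ⟨n⟩⟩ ⟨_, ⟨m⟩⟩ h
    obtain rfl : n = m := by simpa using h
    rfl
  relIdx_range := by
    left
    ext i
    constructor
    · rintro ⟨⟨_, ⟨n⟩⟩, rfl⟩
      simp
    · intro hi
      obtain ⟨n, rfl⟩ : ∃ n, i = n + 1 := ⟨i - 1, by simp at hi; omega⟩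
      exact ⟨⟨n + 1, Rel.path n⟩, rfl⟩
  funIdx_inj := by rintro ⟨_, ⟨⟩⟩
  funIdx_range := by
    right
    refine ⟨0, ?_⟩
    ext i
    constructor
    · rintro ⟨⟨_, ⟨⟩⟩, _⟩
    · intro hi
      have h := hi.1.trans hi.2
      omega
  constIdx_inj := by rintro ⟨⟩ ⟨⟩ _; rfl
  constIdx_range := by
    right
    refine ⟨1, ?_⟩
    ext i
    constructor
    · rintro ⟨_, rfl⟩
      simp
    · intro hi
      exact ⟨Fun.root, le_antisymm hi.1 hi.2⟩

/-- `R_{n+1}(x_0, …, x_n)` holds in `T`. -/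
def IsPath {T : Type} [sig.Structure T] {n : ℕ} (x : Fin (n + 1) → T) : Prop :=
  RelMap (L := sig) (Rel.path n) x

/-- The root `r` of `T`. -/
def root (T : Type) [sig.Structure T] : T := funMap (L := sig) Fun.root default

/-- `T` is a prefix tree: `R_1 = {r}`, and every nonempty prefix of a path is a path. -/
structure IsPrefixTree (T : Type) [sig.Structure T] : Prop where
  path_one : ∀ x : Fin 1 → T, IsPath x ↔ x 0 = root T
  path_prefix : ∀ (n m : ℕ) (h : m ≤ n) (x : Fin (n + 1) → T),
    IsPath x → IsPath (fun i : Fin (m + 1) => x (Fin.castLE (Nat.succ_le_succ h) i))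

/-- `T` is injective: two paths, of any lengths, with the same last element are equal. -/
def IsInjective (T : Type) [sig.Structure T] : Prop :=
  ∀ (n k : ℕ) (x : Fin (n + 1) → T) (y : Fin (k + 1) → T),
    IsPath x → IsPath y → x (Fin.last n) = y (Fin.last k) → List.ofFn x = List.ofFn y

/-- `T` has unbounded depth: for every `n` it has a node at depth `n`, the root being at
depth `0` (that is, a path of `n + 1` elements). -/
def HasUnboundedDepth (T : Type) [sig.Structure T] : Prop :=
  ∀ n : ℕ, ∃ x : Fin (n + 1) → T, IsPath x

/-- `T` is an injective prefix tree of unbounded depth. -/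
def IsInjectiveOfUnboundedDepth (T : Type) [sig.Structure T] : Prop :=
  IsPrefixTree T ∧ IsInjective T ∧ HasUnboundedDepth T

end PrefixTree

/-! The isomorphic copy arises by giving each element of the tree a binary string as its name. Names
are given in stages, and the machine answering a query replays these stages under a clock that
allows one simulated step per letter of the input. The history is a bit list with a `false` for each
simulated step and a `true` for each finished stage. In stage `k` a fixed program computes, from the
history alone, a table of all paths among the elements named so far, those of stage `k` included.
New names are in general a block `1^t` followed by at most two zeros, where `t` is the length of the
history at the end of the stage. Since `t` is unknown while the program runs, the table contains a
symbol for the block, expanded only when the table is compared with the input. Thus the program does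
not refer to its own running time `τ`, and no fixed point is needed.

A tuple containing a name with block `1^t` has length at least `t`, so its clock lasts to the end of
the stage that introduced the name. Names with blocks alone would not exhaust the binary strings.
Therefore each stage may give one unused short string to a new element `q`, chosen together with a
new element `p` that gets a block and lies on every path through `q`. Such pairs exist
(`exists_chooses`): unbounded depth yields a path with two new elements, and by injectivity the part
of a path below an element is determined by that element. So every path is recognized before the
clock runs out, and the answer "no" on a timeout is correct (`accepts_iff`).

The running time is polynomial (`run_stages`): each completed stage uses up some of the clock, which
bounds their number, and a table is no longer than the stack growth in the steps that wrote it
allows. -/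

namespace ClockedMachine

open Turing Turing.TM2.Stmt

/-! ### Counting the steps of a transition system -/

/-- `StepsTo f n a b`: iterating the partial function `f` exactly `n` times leads from `a` to `b`. -/
inductive StepsTo {α : Type*} (f : α → Option α) : ℕ → α → α → Prop
  | refl (a : α) : StepsTo f 0 a a
  | head {n : ℕ} {a b c : α} : f a = some b → StepsTo f n b c → StepsTo f (n + 1) a c

namespace StepsTo

variable {α : Type*} {f : α → Option α}

theorem trans {n m : ℕ} {a b c : α} (h : StepsTo f n a b) (h' : StepsTo f m b c) :
    StepsTo f (n + m) a c := by
  induction h with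
  | refl => simpa using h'
  | head e _ ih =>
    rw [Nat.add_right_comm]
    exact .head e (ih h')

theorem of_reflTransGen {a b : α} (h : Relation.ReflTransGen (fun x y => y ∈ f x) a b) :
    ∃ n, StepsTo f n a b := by
  induction h using Relation.ReflTransGen.head_induction_on with
  | refl => exact ⟨0, .refl _⟩
  | head e _ ih =>
    obtain ⟨n, hn⟩ := ih
    exact ⟨n + 1, .head e hn⟩

theorem iterate {n : ℕ} {a b : α} (h : StepsTo f n a b) : (flip bind f)^[n] (some a) = some b := by
  induction h with
  | refl => rfl
  | head e _ ih =>
    rw [Function.iterate_succ_apply]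
    simpa [flip, e] using ih

end StepsTo

/-- `Within f n a b`: iterating the partial function `f` at most `n` times leads from `a` to
`b`. -/
def Within {α : Type*} (f : α → Option α) (n : ℕ) (a b : α) : Prop :=
  ∃ m ≤ n, StepsTo f m a b

namespace Within

variable {α : Type*} {f : α → Option α}

theorem refl (n : ℕ) (a : α) : Within f n a a := ⟨0, Nat.zero_le _, .refl a⟩

theorem mono {n m : ℕ} {a b : α} (h : Within f n a b) (hm : n ≤ m) : Within f m a b :=
  let ⟨k, hk, hs⟩ := h
  ⟨k, hk.trans hm, hs⟩

theorem trans {n m : ℕ} {a b c : α} (h : Within f n a b) (h' : Within f m b c) :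
    Within f (n + m) a c :=
  let ⟨k, hk, hs⟩ := h
  let ⟨l, hl, hs'⟩ := h'
  ⟨k + l, add_le_add hk hl, hs.trans hs'⟩

theorem head {n : ℕ} {a b c : α} (e : f a = some b) (h : Within f n b c) :
    Within f (n + 1) a c :=
  let ⟨k, hk, hs⟩ := h
  ⟨k + 1, Nat.succ_le_succ hk, .head e hs⟩

theorem single {a b : α} (e : f a = some b) : Within f 1 a b := head e (refl 0 b)

end Within

/-! ### The growth of the stacks -/

section Growth

variable {K : Type} [DecidableEq K] [Fintype K] {Γ : K → Type} {Λ σ : Type}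

/-- The number of symbols on all stacks. -/
def totalSize (S : ∀ k, List (Γ k)) : ℕ := ∑ k, (S k).length

/-- The number of push operations in a statement. -/
def pushCount : TM2.Stmt Γ Λ σ → ℕ
  | push _ _ q => pushCount q + 1
  | peek _ _ q => pushCount q
  | pop _ _ q => pushCount q
  | load _ q => pushCount q
  | branch _ q₁ q₂ => pushCount q₁ + pushCount q₂
  | goto _ => 0
  | halt => 0

theorem totalSize_update_le (S : ∀ k, List (Γ k)) (k : K) (l : List (Γ k)) {n : ℕ}
    (h : l.length ≤ (S k).length + n) : totalSize (Function.update S k l) ≤ totalSize S + n := by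
  unfold totalSize
  rw [← Finset.add_sum_erase _ _ (Finset.mem_univ k),
    ← Finset.add_sum_erase _ (fun k => (S k).length) (Finset.mem_univ k)]
  have : ∑ x ∈ Finset.univ.erase k, (Function.update S k l x).length
      = ∑ x ∈ Finset.univ.erase k, (S x).length := by
    refine Finset.sum_congr rfl fun x hx => ?_
    rw [Function.update_of_ne (Finset.ne_of_mem_erase hx)]
  rw [this, Function.update_self]
  omega

theorem totalSize_stepAux_le (q : TM2.Stmt Γ Λ σ) (v : σ) (S : ∀ k, List (Γ k)) :
    totalSize (TM2.stepAux q v S).stk ≤ totalSize S + pushCount q := by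
  induction q generalizing v S with
  | push k g q ih =>
    have := totalSize_update_le S k (g v :: S k) (n := 1) (by simp)
    have := ih v (Function.update S k (g v :: S k))
    simp only [TM2.stepAux, pushCount]
    omega
  | peek k g q ih => exact ih _ _
  | pop k g q ih =>
    have := totalSize_update_le S k (S k).tail (n := 0) (by simp)
    have := ih (g v (S k).head?) (Function.update S k (S k).tail)
    simp only [TM2.stepAux, pushCount]
    omega
  | load g q ih => exact ih _ _
  | branch g q₁ q₂ ih₁ ih₂ =>
    have := ih₁ v S
    have := ih₂ v S
    simp only [TM2.stepAux, pushCount]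
    cases g v <;> simp only [cond_true, cond_false] <;> omega
  | goto => exact Nat.le_add_right _ _
  | halt => exact Nat.le_add_right _ _

variable [Fintype Λ]

/-- A bound on the growth of the stacks in one step of a program. -/
def growth (M : Λ → TM2.Stmt Γ Λ σ) : ℕ := ∑ l, pushCount (M l)

/-- Bounds the size of an output by the time spent on it; used for the length of the tables and for
the duration of the final clearing. -/
theorem totalSize_le_of_stepsTo (M : Λ → TM2.Stmt Γ Λ σ) {n : ℕ} {c c' : TM2.Cfg Γ Λ σ}
    (h : StepsTo (TM2.step M) n c c') : totalSize c'.stk ≤ totalSize c.stk + n * growth M := by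
  induction h with
  | refl => simp
  | @head n a b c e _ ih =>
    have : totalSize b.stk ≤ totalSize a.stk + growth M := by
      obtain ⟨_ | l, v, S⟩ := a
      · simp at e
      · simp only [TM2.step, Option.some.injEq] at e
        subst e
        refine (totalSize_stepAux_le (M l) v S).trans (Nat.add_le_add_left ?_ _)
        exact Finset.single_le_sum (f := fun l => pushCount (M l)) (fun _ _ => Nat.zero_le _)
          (Finset.mem_univ l)
    rw [Nat.succ_mul]
    omega

theorem totalSize_le_of_within (M : Λ → TM2.Stmt Γ Λ σ) {n : ℕ} {c c' : TM2.Cfg Γ Λ σ}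
    (h : Within (TM2.step M) n c c') : totalSize c'.stk ≤ totalSize c.stk + n * growth M :=
  let ⟨_, hm, hs⟩ := h
  (totalSize_le_of_stepsTo M hs).trans (Nat.add_le_add_left (Nat.mul_le_mul_right _ hm) _)

end Growth

end ClockedMachine

/-! ### A polynomial-time machine that replays a staged computation. -/

namespace ClockedMachine

open Turing Turing.PartrecToTM2 PTimeAlgebra

/-! ### The clocked machine -/

instance : Fintype Letter :=
  ⟨{.zero, .one, .a, .b, .c, .d}, fun l => by cases l <;> decide⟩

/-- The stacks: input, output, the word being compared (`todo`, `done`), the clock, the history of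
the simulation (`hist`, `aux`), and the stacks of the simulated machine. -/
inductive Stk
  | inp | out | todo | done | clk | hist | aux
  | mach (k : K')
  deriving DecidableEq

instance : Fintype Stk :=
  ⟨{.inp, .out, .todo, .done, .clk, .hist, .aux, .mach .main, .mach .rev, .mach .aux, .mach .stack},
    fun k => by rcases k with _ | _ | _ | _ | _ | _ | _ | k <;>
      [skip; skip; skip; skip; skip; skip; skip; cases k] <;> decide⟩

/-- The stack alphabets. -/
@[reducible]
def Sym : Stk → Type
  | .inp => Letter
  | .out => Bool
  | .todo => Letter
  | .done => Letter
  | .clk => Unit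
  | .hist => Bool
  | .aux => Bool
  | .mach _ => Γ'

/-- The finite memory: the register of the simulated machine, a flag, and scratch registers. -/
structure Reg where
  mv : Option Γ'
  ok : Bool
  u : Bool := false
  z : Option Letter := none
  b : Option Bool := none
  g₁ : Option Γ' := none
  g₂ : Option Γ' := none
  g₃ : Option Γ' := none

noncomputable instance : Fintype Reg :=
  Fintype.ofInjective
    (fun s => (((s.mv, s.ok), (s.u, s.z)), ((s.b, s.g₁), (s.g₂, s.g₃))))
    (by rintro ⟨⟩ ⟨⟩ h; simp_all)

/-- The labels of the clocked machine, besides those of the simulated one. -/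
inductive Core
  | init | copy | copyBack | record | check | pad | padBack | restore | clear
  deriving DecidableEq

instance : Fintype Core :=
  ⟨{.init, .copy, .copyBack, .record, .check, .pad, .padBack, .restore, .clear},
    fun l => by cases l <;> decide⟩

/-- The labels of the clocked machine for the code `c`. -/
abbrev Lab (c : ToPartrec.Code) : Type := Core ⊕ {l // l ∈ codeSupp c Cont'.halt}

/-- The statements of the clocked machine for the code `c`. -/
abbrev St (c : ToPartrec.Code) : Type := TM2.Stmt Sym (Lab c) Reg

/-- The labels of the simulated machine as labels of the clocked machine. -/
def lab (c : ToPartrec.Code) (l : Λ') : Lab c :=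
  -- Restricting to `codeSupp` keeps the label set finite. The default `.clear` is never used,
  -- because `tr_supports` confines the simulated machine to this set.
  if h : l ∈ codeSupp c Cont'.halt then .inr ⟨l, h⟩ else .inl .clear

/-- Reset the scratch registers. -/
def Reg.tidy (s : Reg) : Reg := { mv := s.mv, ok := s.ok }

/-- Reset the scratch registers and jump. -/
def jump {c : ToPartrec.Code} (l : Core) : St c := .load Reg.tidy <| .goto fun _ => .inl l

/-- A statement of the simulated machine as a statement of the clocked machine. -/
def embed (c : ToPartrec.Code) : TM2.Stmt (fun _ : K' => Γ') Λ' (Option Γ') → St c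
  | .push k f q => .push (.mach k) (fun s => f s.mv) (embed c q)
  | .peek k f q => .peek (.mach k) (fun s o => { s with mv := f s.mv o }) (embed c q)
  | .pop k f q => .pop (.mach k) (fun s o => { s with mv := f s.mv o }) (embed c q)
  | .load f q => .load (fun s => { s with mv := f s.mv }) (embed c q)
  | .branch f q₁ q₂ => .branch (fun s => f s.mv) (embed c q₁) (embed c q₂)
  | .goto f => .goto fun s => lab c (f s.mv)
  | .halt => .goto fun _ => .inl .record

/-- The letters which are part of the arguments of a query. -/
def isData : Letter → Bool
  | .zero | .one | .d => true
  | _ => false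

/-- A bit as a symbol of the simulated machine. -/
def bitSym (t : Bool) : Γ' := if t then .bit1 else .bit0

/-- The letter coded by a pair of bits. -/
def letterOf : Bool × Bool → Letter
  | (false, false) => .zero
  | (true, false) => .one
  | (_, true) => .d

/-- The program of the clocked machine. -/
def program (c : ToPartrec.Code) : Lab c → St c
  | .inl .init =>
    .pop .inp (fun s o => { s with z := o }) <|
    .branch (fun s => s.z.isSome)
      (.push .clk (fun _ => ()) <|
        .branch (fun s => (s.z.map isData).getD false)
          (.push .todo (fun s => s.z.getD .zero) <| jump .init)
          (jump .init))
      (jump .copy)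
  -- The detour through `aux` preserves `hist` and puts its digits on `main` in the right order,
  -- above the leading `1` and the terminator.
  | .inl .copy =>
    .pop .hist (fun s o => { s with b := o }) <|
    .branch (fun s => s.b.isSome)
      (.push .aux (fun s => s.b.getD false) <| jump .copy)
      (.push (.mach .main) (fun _ => Γ'.cons) <| .push (.mach .main) (fun _ => Γ'.bit1) <|
        jump .copyBack)
  | .inl .copyBack =>
    .pop .aux (fun s o => { s with b := o }) <|
    .branch (fun s => s.b.isSome)
      (.push .hist (fun s => s.b.getD false) <|
        .push (.mach .main) (fun s => bitSym (s.b.getD false)) <| jump .copyBack)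
      (.load Reg.tidy <| .goto fun _ => lab c (trNormal c Cont'.halt))
  -- The tick of the clock, the entry in the history and a whole statement of the simulated machine
  -- form a single step, so both machines count steps alike.
  | .inr l =>
    .pop .clk (fun s o => { s with u := o.isSome }) <|
    .branch (fun s => s.u)
      (.load Reg.tidy <| .push .hist (fun _ => false) <| embed c (tr l.1))
      (.load (fun s => { s with ok := false, mv := none }) <| jump .clear)
  | .inl .record => .push .hist (fun _ => true) <| jump .check
  | .inl .check =>
    -- Each symbol takes three bits, the third being `1` at the end of a word. After the last word
    -- only `bit1` and `cons` remain, so the third pop yields `none` and the next stage begins.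
    .pop (.mach .main) (fun s o => { s with g₁ := o }) <|
    .pop (.mach .main) (fun s o => { s with g₂ := o }) <|
    .pop (.mach .main) (fun s o => { s with g₃ := o }) <|
    .branch (fun s => s.g₃.isNone) (jump .copy) <|
    .branch (fun s => s.g₃ = some .bit1)
      (.peek .todo (fun s o => { s with z := o }) <|
        .branch (fun s => s.z.isNone && s.ok) (jump .clear) (jump .restore)) <|
    -- The pair of ones stands for the block; it is matched with one letter `1` for each entry of
    -- the history.
    .branch (fun s => s.g₁ = some .bit1 && s.g₂ = some .bit1) (jump .pad) <|
    .peek .todo (fun s o => { s with z := o }) <|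
    .branch (fun s => s.z = some (letterOf (s.g₁ = some .bit1, s.g₂ = some .bit1)))
      (.pop .todo (fun s _ => s) <| .push .done (fun s => s.z.getD .zero) <| jump .check)
      (.load (fun s => { s with ok := false }) <| jump .check)
  | .inl .pad =>
    .pop .hist (fun s o => { s with b := o }) <|
    .branch (fun s => s.b.isSome)
      (.push .aux (fun s => s.b.getD false) <|
        .peek .todo (fun s o => { s with z := o }) <|
        .branch (fun s => s.z = some .one)
          (.pop .todo (fun s _ => s) <| .push .done (fun _ => Letter.one) <| jump .pad)
          (.load (fun s => { s with ok := false }) <| jump .pad))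
      (jump .padBack)
  | .inl .padBack =>
    .pop .aux (fun s o => { s with b := o }) <|
    .branch (fun s => s.b.isSome)
      (.push .hist (fun s => s.b.getD false) <| jump .padBack)
      (jump .check)
  | .inl .restore =>
    .pop .done (fun s o => { s with z := o }) <|
    .branch (fun s => s.z.isSome)
      (.push .todo (fun s => s.z.getD .zero) <| jump .restore)
      (.load (fun s => { s with ok := true }) <| jump .check)
  | .inl .clear =>
    -- A halting configuration counts as an output only if all stacks but the output stack are
    -- empty.
    .load (fun s => { s with u := false }) <|
    .pop .todo (fun s o => { s with u := s.u || o.isSome }) <|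
    .pop .done (fun s o => { s with u := s.u || o.isSome }) <|
    .pop .clk (fun s o => { s with u := s.u || o.isSome }) <|
    .pop .hist (fun s o => { s with u := s.u || o.isSome }) <|
    .pop .aux (fun s o => { s with u := s.u || o.isSome }) <|
    .pop (.mach .main) (fun s o => { s with u := s.u || o.isSome }) <|
    .pop (.mach .rev) (fun s o => { s with u := s.u || o.isSome }) <|
    .pop (.mach .aux) (fun s o => { s with u := s.u || o.isSome }) <|
    .pop (.mach .stack) (fun s o => { s with u := s.u || o.isSome }) <|
    .branch (fun s => s.u) (jump .clear) <|
    .push .out (fun s => s.ok) <| .load (fun _ => { mv := none, ok := true }) .halt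

/-- The clocked machine. -/
noncomputable def machine (c : ToPartrec.Code) : FinTM2 where
  K := Stk
  k₀ := .inp
  k₁ := .out
  Γ := Sym
  Λ := Lab c
  main := .inl .init
  σ := Reg
  initialState := { mv := none, ok := true }
  Γk₀Fin := inferInstanceAs (Fintype Letter)
  m := program c

/-! ### Configurations -/

/-- The contents of all stacks. -/
structure Tapes where
  inp : List Letter := []
  out : List Bool := []
  todo : List Letter := []
  done : List Letter := []
  clk : List Unit := []
  hist : List Bool := []
  aux : List Bool := []
  mach : K' → List Γ' := fun _ => []

/-- The stack with a given index. -/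
def Tapes.fn (t : Tapes) : ∀ k, List (Sym k)
  | .inp => t.inp
  | .out => t.out
  | .todo => t.todo
  | .done => t.done
  | .clk => t.clk
  | .hist => t.hist
  | .aux => t.aux
  | .mach k => t.mach k

section

variable (t : Tapes)

@[simp] theorem fn_inp : t.fn .inp = t.inp := rfl
@[simp] theorem fn_out : t.fn .out = t.out := rfl
@[simp] theorem fn_todo : t.fn .todo = t.todo := rfl
@[simp] theorem fn_done : t.fn .done = t.done := rfl
@[simp] theorem fn_clk : t.fn .clk = t.clk := rfl
@[simp] theorem fn_hist : t.fn .hist = t.hist := rfl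
@[simp] theorem fn_aux : t.fn .aux = t.aux := rfl
@[simp] theorem fn_mach (k : K') : t.fn (.mach k) = t.mach k := rfl

@[simp] theorem update_inp (l) : Function.update t.fn .inp l = { t with inp := l }.fn := by
  funext k; cases k <;> rfl
@[simp] theorem update_out (l) : Function.update t.fn .out l = { t with out := l }.fn := by
  funext k; cases k <;> rfl
@[simp] theorem update_todo (l) : Function.update t.fn .todo l = { t with todo := l }.fn := by
  funext k; cases k <;> rfl
@[simp] theorem update_done (l) : Function.update t.fn .done l = { t with done := l }.fn := by
  funext k; cases k <;> rfl
@[simp] theorem update_clk (l) : Function.update t.fn .clk l = { t with clk := l }.fn := by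
  funext k; cases k <;> rfl
@[simp] theorem update_hist (l) : Function.update t.fn .hist l = { t with hist := l }.fn := by
  funext k; cases k <;> rfl
@[simp] theorem update_aux (l) : Function.update t.fn .aux l = { t with aux := l }.fn := by
  funext k; cases k <;> rfl
@[simp] theorem update_mach (k : K') (l) :
    Function.update t.fn (.mach k) l = { t with mach := Function.update t.mach k l }.fn := by
  funext k'
  rcases k' with _ | _ | _ | _ | _ | _ | _ | k' <;> try rfl
  by_cases h : k' = k
  · subst h; simp
  · rw [Function.update_of_ne (by simpa using h)]
    simp [Function.update_of_ne h]

end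

/-- The configuration at a label of the clocked machine, with tidy registers. -/
def conf (c : ToPartrec.Code) (l : Core) (ok : Bool) (t : Tapes) :
    TM2.Cfg Sym (Lab c) Reg :=
  ⟨some (.inl l), { mv := none, ok := ok }, t.fn⟩

/-! ### The phases of the clocked machine -/

/-- The binary number with the given lower digits, followed by a leading `1`. -/
def posNumber : List Bool → PosNum
  | [] => .one
  | true :: h => .bit1 (posNumber h)
  | false :: h => .bit0 (posNumber h)

/-- The number whose binary digits are the given list (the lowest one first), followed by a
leading `1`. -/
def number (h : List Bool) : ℕ := posNumber h

/-- The leading `1` protects trailing zeros of `h`, so that the simulated machine receives and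
returns arbitrary bit lists as numbers. -/
theorem trList_number (h : List Bool) :
    trList [number h] = h.map bitSym ++ [Γ'.bit1, Γ'.cons] := by
  have h₁ : trPosNum (posNumber h) = h.map bitSym ++ [Γ'.bit1] := by
    induction h with
    | nil => rfl
    | cons b h ih => cases b <;> simp [posNumber, trPosNum, bitSym, ih]
  have h₂ : ((number h : ℕ) : Num) = .pos (posNumber h) := by
    have := Num.of_to_nat (.pos (posNumber h))
    rwa [Num.cast_pos] at this
  simp [trList, trNat, h₂, trNum, h₁]

/-- The letters denoted by a symbol, `pad` symbols denoting `n` letters `1`. -/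
def expandSym (n : ℕ) (s : Bool × Bool) : List Letter :=
  if s = (true, true) then List.replicate n .one else [letterOf s]

/-- The word denoted by a list of symbols. -/
def expandWord (n : ℕ) (w : List (Bool × Bool)) : List Letter := w.flatMap (expandSym n)

/-- The bits coding a list of symbols. -/
def symBits (w : List (Bool × Bool)) : List Bool := w.flatMap fun s => [s.1, s.2, false]

/-- The bits coding a table of words. -/
def tableBits (ws : List (List (Bool × Bool))) : List Bool :=
  ws.flatMap fun w => symBits w ++ [false, false, true]

variable {c : ToPartrec.Code}

theorem init_loop (ok : Bool) (zs : List Letter) (t : Tapes) (h : t.inp = zs) :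
    Within (TM2.step (program c)) (zs.length + 1) (conf c .init ok t)
      (conf c .copy ok { t with
        inp := [], clk := List.replicate zs.length () ++ t.clk
        todo := (zs.filter isData).reverse ++ t.todo }) := by
  induction zs generalizing t with
  | nil =>
    refine (Within.single ?_)
    simp [conf, program, jump, Reg.tidy, h]
  | cons z zs ih =>
    have := ih { t with inp := zs, clk := () :: t.clk,
                        todo := if isData z then z :: t.todo else t.todo } rfl
    have key : TM2.step (program c) (conf c .init ok t) = some (conf c .init ok { t with
        inp := zs, clk := () :: t.clk,
        todo := if isData z then z :: t.todo else t.todo }) := by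
      cases hz : isData z <;> simp [conf, program, jump, Reg.tidy, h, hz]
    convert Within.head key this using 3
    all_goals cases hz : isData z <;> simp [hz, List.replicate_succ']

theorem copy_loop (ok : Bool) (hs : List Bool) (t : Tapes) (h : t.hist = hs) :
    Within (TM2.step (program c)) (hs.length + 1) (conf c .copy ok t)
      (conf c .copyBack ok { t with
        hist := [], aux := hs.reverse ++ t.aux
        mach := Function.update t.mach .main (.bit1 :: .cons :: t.mach .main) }) := by
  induction hs generalizing t with
  | nil =>
    refine (Within.single ?_)
    simp [conf, program, jump, Reg.tidy, h]
  | cons b hs ih =>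
    have := ih { t with hist := hs, aux := b :: t.aux } rfl
    have key : TM2.step (program c) (conf c .copy ok t) = some (conf c .copy ok { t with
        hist := hs, aux := b :: t.aux }) := by
      simp [conf, program, jump, Reg.tidy, h]
    convert Within.head key this using 3
    all_goals simp

theorem copyBack_loop (ok : Bool) (bs : List Bool) (t : Tapes) (h : t.aux = bs) :
    Within (TM2.step (program c)) (bs.length + 1) (conf c .copyBack ok t)
      ⟨some (lab c (trNormal c Cont'.halt)), { mv := none, ok := ok }, { t with
        aux := [], hist := bs.reverse ++ t.hist
        mach := Function.update t.mach .main
          (bs.reverse.map bitSym ++ t.mach .main) : Tapes }.fn⟩ := by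
  induction bs generalizing t with
  | nil =>
    refine (Within.single ?_)
    simp [conf, program, Reg.tidy, h]
  | cons b bs ih =>
    have := ih { t with aux := bs, hist := b :: t.hist,
                        mach := Function.update t.mach .main (bitSym b :: t.mach .main) } rfl
    have key : TM2.step (program c) (conf c .copyBack ok t) = some (conf c .copyBack ok { t with
        aux := bs, hist := b :: t.hist
        mach := Function.update t.mach .main (bitSym b :: t.mach .main) }) := by
      simp [conf, program, jump, Reg.tidy, h]
    convert Within.head key this using 4
    all_goals simp

/-- The configurations of the simulated machine. -/
abbrev MCfg : Type := TM2.Cfg (fun _ : K' => Γ') Λ' (Option Γ')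

/-- The statements of the simulated machine. -/
abbrev MStmt : Type := TM2.Stmt (fun _ : K' => Γ') Λ' (Option Γ')

/-- A configuration of the simulated machine as a configuration of the clocked machine. -/
def embedCfg (c : ToPartrec.Code) (a : MCfg) (t : Tapes) : TM2.Cfg Sym (Lab c) Reg :=
  ⟨some (a.l.elim (.inl .record) (lab c)), { mv := a.var, ok := true }, { t with mach := a.stk }.fn⟩

theorem start_run (t : Tapes) (haux : t.aux = []) (hm : t.mach = fun _ => []) :
    Within (TM2.step (program c)) (2 * t.hist.length + 2) (conf c .copy true t)
      (embedCfg c (init c [number t.hist]) t) := by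
  have h₁ := copy_loop (c := c) true t.hist t rfl
  have h₂ := copyBack_loop (c := c) true _ { t with
    hist := [], aux := t.hist.reverse ++ t.aux
    mach := Function.update t.mach .main (.bit1 :: .cons :: t.mach .main) } rfl
  have := h₁.trans h₂
  refine Eq.mp ?_ (this.mono (m := 2 * t.hist.length + 2) (by simp [haux]; omega))
  congr 1
  simp only [embedCfg, init, trList_number, haux, hm]
  congr 2
  simp only [List.reverse_reverse, List.append_nil, Function.update_self, Function.update_idem]
  congr 1
  funext k
  cases k <;> simp

theorem embed_stepAux (q : MStmt) (v : Option Γ') (t : Tapes) (S : K' → List Γ') :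
    TM2.stepAux (embed c q) { mv := v, ok := true } { t with mach := S }.fn =
      embedCfg c (TM2.stepAux q v S) t := by
  induction q generalizing v S with
  | push k f q ih => simp [embed, ih]
  | peek k f q ih => simp [embed, ih]
  | pop k f q ih => simp [embed, ih]
  | load f q ih => simp [embed, ih]
  | branch f q₁ q₂ ih₁ ih₂ => cases hf : f v <;> simp [embed, ih₁, ih₂, hf]
  | goto f => simp [embed, embedCfg]
  | halt => simp [embed, embedCfg]

theorem mem_insertNone_of_step {a b : MCfg} (h : TM2.step tr a = some b)
    (ha : a.l ∈ Finset.insertNone (codeSupp c Cont'.halt)) :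
    b.l ∈ Finset.insertNone (codeSupp c Cont'.halt) :=
  @TM2.step_supports _ _ _ _ ⟨trNormal c Cont'.halt⟩ _ tr _ (tr_supports c Cont'.halt) _ _ h ha

theorem embed_step {a b : MCfg} (h : TM2.step tr a = some b)
    (ha : a.l ∈ Finset.insertNone (codeSupp c Cont'.halt)) (t : Tapes) (n : List Unit)
    (ht : t.clk = () :: n) :
    TM2.step (program c) (embedCfg c a t) =
      some (embedCfg c b { t with clk := n, hist := false :: t.hist }) := by
  obtain ⟨_ | l, v, S⟩ := a
  · exact absurd (show none = some b from h) (by simp)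
  · have hl : l ∈ codeSupp c Cont'.halt := by simpa using ha
    obtain rfl : TM2.stepAux (tr l) v S = b := Option.some.inj h
    simp only [embedCfg, Option.elim, lab, hl, dif_pos, TM2.step, program, TM2.stepAux, fn_clk, ht,
      List.head?_cons, Option.isSome_some, cond_true, Reg.tidy, List.tail_cons, update_clk, fn_hist,
      update_hist]
    exact congrArg some
      (embed_stepAux (tr l) v { t with clk := n, hist := false :: t.hist } S)

theorem run_machine {n : ℕ} {a b : MCfg} (h : StepsTo (TM2.step tr) n a b)
    (ha : a.l ∈ Finset.insertNone (codeSupp c Cont'.halt)) (t : Tapes) (hn : n ≤ t.clk.length) :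
    StepsTo (TM2.step (program c)) n (embedCfg c a t)
      (embedCfg c b { t with clk := t.clk.drop n, hist := List.replicate n false ++ t.hist }) := by
  induction h generalizing t with
  | refl a => exact .refl _
  | @head n a b d e _ ih =>
    obtain ⟨m, hm⟩ : ∃ m, t.clk = () :: m := by
      cases hc : t.clk with
      | nil => simp [hc] at hn
      | cons u m => exact ⟨m, rfl⟩
    have := ih (mem_insertNone_of_step e ha) { t with clk := m, hist := false :: t.hist }
      (by simp [hm] at hn ⊢; omega)
    refine Eq.mp ?_ (StepsTo.head (embed_step e ha t m hm) this)
    simp [hm, List.replicate_succ']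

/-- What is left on the other stacks does not matter, since it is about to be erased; only the two
stacks that clearing does not pop are tracked. -/
theorem run_timeout {n : ℕ} {a b : MCfg} (h : StepsTo (TM2.step tr) n a b)
    (ha : a.l ∈ Finset.insertNone (codeSupp c Cont'.halt)) (t : Tapes) (hn : t.clk.length < n) :
    ∃ t', Within (TM2.step (program c)) (t.clk.length + 1) (embedCfg c a t)
      (conf c .clear false t') ∧ t'.inp = t.inp ∧ t'.out = t.out := by
  induction h generalizing t with
  | refl a => simp at hn
  | @head n a b d e _ ih =>
    cases hc : t.clk with
    | nil =>
      obtain ⟨_ | l, v, S⟩ := a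
      · exact absurd (show none = some b from e) (by simp)
      · have hl : l ∈ codeSupp c Cont'.halt := by simpa using ha
        refine ⟨{ t with mach := S }, (Within.single ?_).mono (by simp), rfl, rfl⟩
        simp [embedCfg, lab, hl, program, hc, jump, Reg.tidy, conf]
    | cons u m =>
      obtain ⟨t', h₁, h₂⟩ := ih (mem_insertNone_of_step e ha)
        { t with clk := m, hist := false :: t.hist } (by simp [hc] at hn ⊢; omega)
      exact ⟨t', (Within.head (embed_step e ha t m hc) h₁).mono (by simp), h₂⟩

variable {c : ToPartrec.Code}

/-! ### Comparing the input with a table of words -/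

/-- The comparison of the word `x` with a word starting with `u`: `done` has been matched, `todo`
is still to be matched, and `ok` tells whether `u` is a prefix of `x`. -/
structure Compared (x u : List Letter) (ok : Bool) (todo done : List Letter) : Prop where
  eq : done.reverse ++ todo = x
  prefix_iff : ok = true ↔ u <+: x
  done_eq : ok = true → done.reverse = u

theorem Compared.start (x : List Letter) : Compared x [] true x [] := ⟨by simp, by simp, by simp⟩

/-- After a mismatch later letters may still move to `done`. This is harmless: `ok` stays false, and
`done` can always be poured back to recover `x`. -/
theorem Compared.letter {x u : List Letter} {ok : Bool} {todo done : List Letter}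
    (h : Compared x u ok todo done) (z : Letter) :
    (∀ r, todo = z :: r → Compared x (u ++ [z]) ok r (z :: done)) ∧
      (todo.head? ≠ some z → Compared x (u ++ [z]) false todo done) := by
  obtain ⟨h₁, h₂, h₃⟩ := h
  constructor
  · rintro r rfl
    refine ⟨by simpa using h₁, ⟨fun hok => ?_, fun hp => h₂.2 ((List.prefix_append u [z]).trans hp)⟩,
      fun hok => by simp [h₃ hok]⟩
    rw [← h₁, h₃ hok]
    exact ⟨r, by simp⟩
  · intro hz
    refine ⟨h₁, ⟨fun hok => by simp at hok, fun hp => ?_⟩, fun hok => by simp at hok⟩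
    have hok := h₂.2 ((List.prefix_append u [z]).trans hp)
    obtain ⟨r, hr⟩ := hp
    rw [← h₁, h₃ hok, List.append_assoc] at hr
    have := List.append_cancel_left hr
    simp [← this] at hz

theorem check_letter {x u : List Letter} {ok : Bool} {t : Tapes}
    (h : Compared x u ok t.todo t.done) (s : Bool × Bool) (hs : s ≠ (true, true)) (m : List Γ')
    (hm : t.mach .main = bitSym s.1 :: bitSym s.2 :: .bit0 :: m) :
    ∃ ok' todo' done', Compared x (u ++ [letterOf s]) ok' todo' done' ∧
      TM2.step (program c) (conf c .check ok t) = some (conf c .check ok' { t with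
        todo := todo', done := done', mach := Function.update t.mach .main m }) := by
  have h₁ : (decide (bitSym s.1 = .bit1), decide (bitSym s.2 = .bit1)) = s := by
    rcases s with ⟨_ | _, _ | _⟩ <;> rfl
  have h₂ : (decide (bitSym s.1 = .bit1) && decide (bitSym s.2 = .bit1)) = false := by
    rcases s with ⟨_ | _, _ | _⟩ <;> simp [bitSym] at hs ⊢
  by_cases hz : t.todo.head? = some (letterOf s)
  · obtain ⟨r, hr⟩ : ∃ r, t.todo = letterOf s :: r := by
      cases ht : t.todo with
      | nil => simp [ht] at hz
      | cons y r => exact ⟨r, by simpa [ht] using hz⟩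
    refine ⟨_, _, _, (h.letter (letterOf s)).1 r hr, ?_⟩
    simp [conf, program, jump, Reg.tidy, hm, h₁, h₂, hr]
  · refine ⟨_, _, _, (h.letter (letterOf s)).2 hz, ?_⟩
    simp [conf, program, jump, Reg.tidy, hm, h₁, h₂, hz]

theorem pad_loop {x u : List Letter} {ok : Bool} {t : Tapes} (hs : List Bool)
    (h : Compared x u ok t.todo t.done) (ht : t.hist = hs) :
    ∃ ok' todo' done', Compared x (u ++ List.replicate hs.length .one) ok' todo' done' ∧
      Within (TM2.step (program c)) (hs.length + 1) (conf c .pad ok t)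
        (conf c .padBack ok' { t with
          todo := todo', done := done', hist := [], aux := hs.reverse ++ t.aux }) := by
  induction hs generalizing u ok t with
  | nil =>
    refine ⟨ok, t.todo, t.done, by simpa using h, Within.single ?_⟩
    simp [conf, program, jump, Reg.tidy, ht]
  | cons b hs ih =>
    obtain ⟨ok₁, todo₁, done₁, h₁, e⟩ : ∃ ok' todo' done',
        Compared x (u ++ [.one]) ok' todo' done' ∧
          TM2.step (program c) (conf c .pad ok t) = some (conf c .pad ok' { t with
            todo := todo', done := done', hist := hs, aux := b :: t.aux }) := by
      by_cases hz : t.todo.head? = some .one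
      · obtain ⟨r, hr⟩ : ∃ r, t.todo = .one :: r := by
          cases ht : t.todo with
          | nil => simp [ht] at hz
          | cons y r => exact ⟨r, by simpa [ht] using hz⟩
        refine ⟨_, _, _, (h.letter .one).1 r hr, ?_⟩
        simp [conf, program, jump, Reg.tidy, ht, hr]
      · refine ⟨_, _, _, (h.letter .one).2 hz, ?_⟩
        simp [conf, program, jump, Reg.tidy, ht, hz]
    obtain ⟨ok', todo', done', h₂, h₃⟩ := ih (t := { t with
      todo := todo₁, done := done₁, hist := hs, aux := b :: t.aux }) h₁ rfl
    refine ⟨ok', todo', done', by simpa [List.replicate_succ] using h₂, ?_⟩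
    convert Within.head e h₃ using 3
    all_goals simp

theorem padBack_loop (ok : Bool) (bs : List Bool) (t : Tapes) (h : t.aux = bs) :
    Within (TM2.step (program c)) (bs.length + 1) (conf c .padBack ok t)
      (conf c .check ok { t with aux := [], hist := bs.reverse ++ t.hist }) := by
  induction bs generalizing t with
  | nil =>
    refine Within.single ?_
    simp [conf, program, jump, Reg.tidy, h]
  | cons b bs ih =>
    have := ih { t with aux := bs, hist := b :: t.hist } rfl
    have key : TM2.step (program c) (conf c .padBack ok t) = some (conf c .padBack ok { t with
        aux := bs, hist := b :: t.hist }) := by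
      simp [conf, program, jump, Reg.tidy, h]
    convert Within.head key this using 3
    all_goals simp

theorem check_symbol {x u : List Letter} {ok : Bool} {t : Tapes}
    (h : Compared x u ok t.todo t.done) (haux : t.aux = []) (s : Bool × Bool) (m : List Γ')
    (hm : t.mach .main = bitSym s.1 :: bitSym s.2 :: .bit0 :: m) :
    ∃ ok' todo' done', Compared x (u ++ expandSym t.hist.length s) ok' todo' done' ∧
      Within (TM2.step (program c)) (2 * t.hist.length + 3) (conf c .check ok t)
        (conf c .check ok' { t with
          todo := todo', done := done', mach := Function.update t.mach .main m }) := by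
  by_cases hs : s = (true, true)
  · subst hs
    have key : TM2.step (program c) (conf c .check ok t) = some (conf c .pad ok { t with
        mach := Function.update t.mach .main m }) := by
      simp [conf, program, jump, Reg.tidy, hm, bitSym]
    obtain ⟨ok', todo', done', h₁, h₂⟩ := pad_loop (c := c) (t := { t with
        mach := Function.update t.mach .main m }) t.hist h rfl
    refine ⟨ok', todo', done', by simpa [expandSym] using h₁, ?_⟩
    have h₃ := padBack_loop (c := c) ok' _ { t with
      todo := todo', done := done', hist := [], aux := t.hist.reverse ++ t.aux
      mach := Function.update t.mach .main m } rfl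
    have h₄ := (Within.head key (h₂.trans h₃)).mono (m := 2 * t.hist.length + 3)
      (by simp [haux]; omega)
    convert h₄ using 3
    all_goals simp [haux]
  · obtain ⟨ok', todo', done', h₁, h₂⟩ := check_letter (c := c) h s hs m hm
    exact ⟨ok', todo', done', by simpa [expandSym, hs] using h₁, (Within.single h₂).mono (by omega)⟩

theorem check_word {x u : List Letter} {ok : Bool} {t : Tapes} (w : List (Bool × Bool))
    (h : Compared x u ok t.todo t.done) (haux : t.aux = []) (m : List Γ')
    (hm : t.mach .main = (symBits w).map bitSym ++ m) :
    ∃ ok' todo' done', Compared x (u ++ expandWord t.hist.length w) ok' todo' done' ∧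
      Within (TM2.step (program c)) (w.length * (2 * t.hist.length + 3)) (conf c .check ok t)
        (conf c .check ok' { t with
          todo := todo', done := done', mach := Function.update t.mach .main m }) := by
  induction w generalizing u ok t with
  | nil =>
    refine ⟨ok, t.todo, t.done, by simpa [expandWord] using h, ?_⟩
    have : m = t.mach .main := by simp [hm, symBits]
    rw [this, Function.update_eq_self]
    exact Within.refl _ _
  | cons s w ih =>
    obtain ⟨ok₁, todo₁, done₁, h₁, e₁⟩ := check_symbol (c := c) h haux s
      ((symBits w).map bitSym ++ m) (by simp [hm, symBits, bitSym])
    obtain ⟨ok₂, todo₂, done₂, h₂, e₂⟩ := ih (t := { t with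
      todo := todo₁, done := done₁
      mach := Function.update t.mach .main ((symBits w).map bitSym ++ m) }) h₁ haux (by simp)
    refine ⟨ok₂, todo₂, done₂, by simpa [expandWord] using h₂, ?_⟩
    have := (e₁.trans e₂).mono (m := (s :: w).length * (2 * t.hist.length + 3))
      (le_of_eq (by rw [List.length_cons, Nat.succ_mul w.length]; exact Nat.add_comm _ _))
    convert this using 3
    simp

theorem restore_loop (ok : Bool) (zs : List Letter) (t : Tapes) (h : t.done = zs) :
    Within (TM2.step (program c)) (zs.length + 1) (conf c .restore ok t)
      (conf c .check true { t with done := [], todo := zs.reverse ++ t.todo }) := by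
  induction zs generalizing t with
  | nil =>
    refine Within.single ?_
    simp [conf, program, jump, Reg.tidy, h]
  | cons z zs ih =>
    have := ih { t with done := zs, todo := z :: t.todo } rfl
    have key : TM2.step (program c) (conf c .restore ok t) = some (conf c .restore ok { t with
        done := zs, todo := z :: t.todo }) := by
      simp [conf, program, jump, Reg.tidy, h]
    convert Within.head key this using 3
    all_goals simp

/-- Equality means being a prefix with nothing left to match. In the other case `x` is restored for
the next word. -/
theorem check_end {x u : List Letter} {ok : Bool} {t : Tapes}
    (h : Compared x u ok t.todo t.done) (m : List Γ')
    (hm : t.mach .main = .bit0 :: .bit0 :: .bit1 :: m) :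
    (x = u → ∃ t', Within (TM2.step (program c)) 1 (conf c .check ok t) (conf c .clear true t') ∧
      t'.inp = t.inp ∧ t'.out = t.out) ∧
    (x ≠ u → Within (TM2.step (program c)) (x.length + 2) (conf c .check ok t)
      (conf c .check true { t with
        todo := x, done := [], mach := Function.update t.mach .main m })) := by
  constructor
  · rintro rfl
    have hok : ok = true := h.prefix_iff.2 List.prefix_rfl
    have htodo : t.todo = [] := by
      have := h.eq
      rw [h.done_eq hok] at this
      simpa using this
    refine ⟨{ t with mach := Function.update t.mach .main m }, Within.single ?_, rfl, rfl⟩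
    simp [conf, program, jump, Reg.tidy, hm, htodo, hok]
  · intro hne
    have hb : ¬ (t.todo = [] ∧ ok = true) := by
      rintro ⟨h₁, h₂⟩
      have := h.eq
      rw [h.done_eq h₂, h₁, List.append_nil] at this
      exact hne this.symm
    have key : TM2.step (program c) (conf c .check ok t) = some (conf c .restore ok { t with
        mach := Function.update t.mach .main m }) := by
      cases ht : t.todo with
      | nil =>
        have : ok = false := by simpa [ht] using hb
        simp [conf, program, jump, Reg.tidy, hm, ht, this]
      | cons z r => simp [conf, program, jump, Reg.tidy, hm, ht]
    have := restore_loop (c := c) ok t.done { t with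
      mach := Function.update t.mach .main m } rfl
    have hl : t.done.length ≤ x.length := by rw [← h.eq]; simp
    have := (Within.head key this).mono (m := x.length + 2) (by omega)
    convert this using 3
    exact h.eq.symm

theorem check_table {x : List Letter} {t : Tapes} (ws : List (List (Bool × Bool)))
    (htodo : t.todo = x) (hdone : t.done = []) (haux : t.aux = []) (m : List Γ')
    (hm : t.mach .main = (tableBits ws).map bitSym ++ m) :
    (x ∈ ws.map (expandWord t.hist.length) → ∃ t',
      Within (TM2.step (program c)) ((tableBits ws).length * (2 * t.hist.length + x.length + 5))
        (conf c .check true t) (conf c .clear true t') ∧ t'.inp = t.inp ∧ t'.out = t.out) ∧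
    (x ∉ ws.map (expandWord t.hist.length) →
      Within (TM2.step (program c)) ((tableBits ws).length * (2 * t.hist.length + x.length + 5))
        (conf c .check true t)
        (conf c .check true { t with mach := Function.update t.mach .main m })) := by
  induction ws generalizing t with
  | nil =>
    refine ⟨fun h => by simp at h, fun _ => ?_⟩
    have : m = t.mach .main := by simp [hm, tableBits]
    rw [this, Function.update_eq_self]
    exact Within.refl _ _
  | cons w ws ih =>
    set m' := (tableBits ws).map bitSym ++ m with hm'
    obtain ⟨ok₁, todo₁, done₁, h₁, e₁⟩ := check_word (c := c) (t := t) w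
      (by rw [htodo, hdone]; exact Compared.start x) haux (.bit0 :: .bit0 :: .bit1 :: m')
      (by simp [hm, hm', tableBits, bitSym])
    rw [List.nil_append] at h₁
    obtain ⟨h₂, h₃⟩ := check_end (c := c) (t := { t with
      todo := todo₁, done := done₁
      mach := Function.update t.mach .main (.bit0 :: .bit0 :: .bit1 :: m') }) h₁ m' (by simp)
    have hlen : (tableBits (w :: ws)).length = 3 * w.length + 3 + (tableBits ws).length := by
      simp [tableBits, symBits]; omega
    -- The `3 * w.length + 3` bits of `w` in the table pay for matching its symbols, each of them
    -- possibly a block, and for restoring `x`.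
    have hb : w.length * (2 * t.hist.length + 3) + (x.length + 2) ≤
        (3 * w.length + 3) * (2 * t.hist.length + x.length + 5) := by nlinarith
    have hb' : (tableBits (w :: ws)).length * (2 * t.hist.length + x.length + 5) =
        (3 * w.length + 3) * (2 * t.hist.length + x.length + 5) +
          (tableBits ws).length * (2 * t.hist.length + x.length + 5) := by
      rw [hlen, Nat.add_mul]
    by_cases hx : x = expandWord t.hist.length w
    · obtain ⟨t', h₄, h₅⟩ := h₂ hx
      exact ⟨fun _ => ⟨t', (e₁.trans h₄).mono (by omega), h₅⟩, fun h => by simp [hx] at h⟩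
    · have h₄ := h₃ hx
      obtain ⟨h₅, h₆⟩ := ih (t := { t with
        todo := x, done := [], mach := Function.update t.mach .main m' }) rfl rfl haux (by simp [hm'])
      have e₂ := e₁.trans h₄
      simp only [Function.update_idem] at e₂
      constructor
      · intro h
        obtain ⟨t', h₇, h₈⟩ := h₅ (by simpa [hx] using h)
        exact ⟨t', (e₂.trans h₇).mono (by simp only; omega), h₈⟩
      · intro h
        have h₇ := h₆ (by simpa [hx] using h)
        simp only [Function.update_idem] at h₇
        refine Eq.mp ?_ ((e₂.trans h₇).mono
          (m := (tableBits (w :: ws)).length * (2 * t.hist.length + x.length + 5)) (by omega))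
        rw [htodo, hdone]

variable {c : ToPartrec.Code}

/-! ### The stages of the simulation -/

theorem totalSize_tapes (t : Tapes) : totalSize t.fn =
    t.inp.length + t.out.length + t.todo.length + t.done.length + t.clk.length + t.hist.length +
      t.aux.length + (t.mach .main).length + (t.mach .rev).length + (t.mach .aux).length +
      (t.mach .stack).length := by
  have : (Finset.univ : Finset Stk) = {.inp, .out, .todo, .done, .clk, .hist, .aux, .mach .main,
    .mach .rev, .mach .aux, .mach .stack} := rfl
  simp only [totalSize, this]
  repeat rw [Finset.sum_insert (by decide)]
  rw [Finset.sum_singleton]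
  simp only [fn_inp, fn_out, fn_todo, fn_done, fn_clk, fn_hist, fn_aux, fn_mach]
  omega

/-- The history after one more run of the simulated machine. -/
def nextHist (τ : List Bool → ℕ) (h : List Bool) : List Bool :=
  true :: (List.replicate (τ h) false ++ h)

/-- The word `x` occurs in one of the tables produced from the history `h` on, while the clock
allows `n` further steps. -/
def Accepts (g : List Bool → List (List (Bool × Bool))) (τ : List Bool → ℕ) (n : ℕ)
    (h : List Bool) (x : List Letter) : Prop :=
  -- The table of stage `j` is compared only after that stage has ended, so the history with index
  -- `j + 1` gives both the clock condition and the block length.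
  ∃ j, ((nextHist τ)^[j + 1] h).count false ≤ n + h.count false ∧
    x ∈ (g ((nextHist τ)^[j] h)).map (expandWord ((nextHist τ)^[j + 1] h).length)

section

variable {g : List Bool → List (List (Bool × Bool))} {τ : List Bool → ℕ}

theorem count_false_nextHist (h : List Bool) :
    (nextHist τ h).count false = τ h + h.count false := by
  simp [nextHist]

theorem count_false_le_iterate (h : List Bool) (j : ℕ) :
    h.count false ≤ ((nextHist τ)^[j] h).count false := by
  induction j with
  | zero => exact le_rfl
  | succ j ih => rw [Function.iterate_succ_apply', count_false_nextHist]; omega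

/-- The number of simulated steps never decreases along the stages, so if the present stage cannot
finish, no later one can. -/
theorem not_accepts_of_lt {n : ℕ} {h : List Bool} {x : List Letter} (hn : n < τ h) :
    ¬ Accepts g τ n h x := by
  rintro ⟨j, hj, -⟩
  have := count_false_le_iterate (τ := τ) (nextHist τ h) j
  rw [count_false_nextHist] at this
  rw [Function.iterate_succ_apply] at hj
  omega

theorem accepts_iff_of_notMem {n : ℕ} {h : List Bool} {x : List Letter} (hn : τ h ≤ n)
    (hx : x ∉ (g h).map (expandWord (nextHist τ h).length)) :
    Accepts g τ n h x ↔ Accepts g τ (n - τ h) (nextHist τ h) x := by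
  have key : n - τ h + (nextHist τ h).count false = n + h.count false := by
    rw [count_false_nextHist]; omega
  constructor
  · rintro ⟨_ | j, hj, hj'⟩
    · exact absurd hj' hx
    · exact ⟨j, key ▸ hj, hj'⟩
  · rintro ⟨j, hj, hj'⟩
    exact ⟨j + 1, key ▸ hj, hj'⟩

/-- The code `c` computes `g`, and `τ` is the running time of the simulated machine. -/
structure Computes (c : ToPartrec.Code) (g : List Bool → List (List (Bool × Bool)))
    (τ : List Bool → ℕ) : Prop where
  -- Makes each stage consume some of the clock, which bounds the number of stages.
  pos : ∀ h, 0 < τ h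
  run : ∀ h, StepsTo (TM2.step tr) (τ h) (init c [number h]) (halt [number (tableBits (g h))])

/-- A bound for the duration of a stage which starts with `N` symbols on the stacks. -/
def stageBound (G N : ℕ) : ℕ := (2 * N + 3) + (N + (2 * N + 3) * G) * (3 * N + 7) + 1

theorem stageBound_mono (G : ℕ) {N N' : ℕ} (h : N ≤ N') : stageBound G N ≤ stageBound G N' := by
  unfold stageBound
  gcongr

/-- The tapes at the beginning of a stage. -/
def stageTapes (x : List Letter) (n : List Unit) (h : List Bool) : Tapes :=
  { todo := x, clk := n, hist := h }

variable (hc : Computes c g τ)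

include hc in
theorem stage_timeout (x : List Letter) (n : List Unit) (h : List Bool) (hn : n.length < τ h) :
    ∃ t', Within (TM2.step (program c)) (stageBound (growth (program c)) (x.length + n.length + h.length))
      (conf c .copy true (stageTapes x n h)) (conf c .clear false t') ∧ t'.inp = [] ∧ t'.out = [] := by
  have h₁ := start_run (c := c) (stageTapes x n h) rfl rfl
  obtain ⟨t', h₂, h₃, h₄⟩ := run_timeout (c := c) (hc.run h)
    (by simpa [init] using codeSupp_self c _ (trStmts₁_self _)) (stageTapes x n h) hn
  refine ⟨t', (h₁.trans h₂).mono ?_, h₃, h₄⟩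
  simp only [stageTapes, stageBound]
  omega

-- The summands of `stageBound` pay for loading the history, simulating and recording the end of the
-- stage; for the comparison with the table; and for the return to `.copy`.
include hc in
theorem stage_run (x : List Letter) (n : List Unit) (h : List Bool) (hn : τ h ≤ n.length) :
    (x ∈ (g h).map (expandWord (nextHist τ h).length) →
      ∃ t', Within (TM2.step (program c))
        (stageBound (growth (program c)) (x.length + n.length + h.length))
        (conf c .copy true (stageTapes x n h)) (conf c .clear true t') ∧
        t'.inp = [] ∧ t'.out = []) ∧
    (x ∉ (g h).map (expandWord (nextHist τ h).length) →
      Within (TM2.step (program c))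
        (stageBound (growth (program c)) (x.length + n.length + h.length))
        (conf c .copy true (stageTapes x n h))
        (conf c .copy true (stageTapes x (n.drop (τ h)) (nextHist τ h)))) := by
  set N := x.length + n.length + h.length with hN
  have h₁ := start_run (c := c) (stageTapes x n h) rfl rfl
  have h₂ := run_machine (c := c) (hc.run h)
    (by simpa [init] using codeSupp_self c _ (trStmts₁_self _)) (stageTapes x n h) hn
  let t₁ : Tapes := { todo := x, clk := n.drop (τ h), hist := nextHist τ h,
                      mach := K'.elim (trList [number (tableBits (g h))]) [] [] [] }
  have h₃ : TM2.step (program c) (embedCfg c (halt [number (tableBits (g h))])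
      { stageTapes x n h with clk := n.drop (τ h), hist := List.replicate (τ h) false ++ h }) =
      some (conf c .check true t₁) := by
    simp [embedCfg, halt, conf, program, jump, Reg.tidy, t₁, stageTapes, nextHist]
  have h₄ : Within (TM2.step (program c)) (2 * N + 3) (conf c .copy true (stageTapes x n h))
      (conf c .check true t₁) := by
    refine ((h₁.trans ⟨_, le_rfl, h₂⟩).trans (Within.single h₃)).mono ?_
    simp only [stageTapes]
    omega
  -- When the comparison starts, the table lies on `main`, hence is no longer than the total size of
  -- the stacks.
  have hsize : (tableBits (g h)).length ≤ N + (2 * N + 3) * growth (program c) := by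
    have := totalSize_le_of_within _ h₄
    simp only [conf, totalSize_tapes, t₁, stageTapes, K'.elim, trList_number, List.length_append,
      List.length_map, List.length_nil] at this
    omega
  have hhist : (nextHist τ h).length ≤ N + 1 := by
    simp only [nextHist, List.length_cons, List.length_append, List.length_replicate]
    omega
  obtain ⟨h₅, h₆⟩ := check_table (c := c) (x := x) (t := t₁) (g h) rfl rfl rfl [.bit1, .cons]
    (by simp only [t₁, K'.elim, trList_number])
  have hb : (tableBits (g h)).length * (2 * t₁.hist.length + x.length + 5) ≤
      (N + (2 * N + 3) * growth (program c)) * (3 * N + 7) :=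
    Nat.mul_le_mul hsize (by simp only [t₁]; omega)
  constructor
  · intro hx
    obtain ⟨t', h₇, h₈⟩ := h₅ hx
    exact ⟨t', (h₄.trans h₇).mono (by unfold stageBound; omega), h₈⟩
  · intro hx
    have h₇ : TM2.step (program c) (conf c .check true { t₁ with
        mach := Function.update t₁.mach .main [.bit1, .cons] }) =
        some (conf c .copy true (stageTapes x (n.drop (τ h)) (nextHist τ h))) := by
      have : (fun _ => [] : K' → List Γ') = K'.elim [] [] [] [] := by
        funext k; cases k <;> rfl
      simp [conf, program, jump, Reg.tidy, t₁, stageTapes, this]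
    exact ((h₄.trans (h₆ hx)).trans (Within.single h₇)).mono (by unfold stageBound; omega)

-- Induction on the remaining clock. A stage adds one `true` and at least one `false`, so `htrue`
-- persists and the history is at most twice as long as the number of simulated steps. The quantity
-- bounded by `B` is invariant, since each simulated step moves one unit from the clock to the
-- history.
include hc in
theorem run_stages (x : List Letter) (B : ℕ) (n : List Unit) (h : List Bool)
    (htrue : h.count true ≤ h.count false)
    (hB : x.length + 2 * n.length + 2 * h.count false ≤ B) :
    ∃ ok t', Within (TM2.step (program c))
        ((n.length + 1) * stageBound (growth (program c)) B)
        (conf c .copy true (stageTapes x n h)) (conf c .clear ok t') ∧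
      (ok = true ↔ Accepts g τ n.length h x) ∧ t'.inp = [] ∧ t'.out = [] := by
  induction hm : n.length using Nat.strong_induction_on generalizing n h with
  | _ m ih =>
  subst hm
  have hlen : h.length = h.count true + h.count false := (List.count_true_add_count_false h).symm
  have hN := stageBound_mono (growth (program c)) (N := x.length + n.length + h.length) (N' := B)
    (by omega)
  set S := stageBound (growth (program c)) B
  have hS : S ≤ (n.length + 1) * S := Nat.le_mul_of_pos_left _ (Nat.succ_pos _)
  rcases lt_or_ge n.length (τ h) with hn | hn
  · obtain ⟨t', h₁, h₂⟩ := stage_timeout hc x n h hn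
    exact ⟨false, t', h₁.mono (hN.trans hS), by simpa using not_accepts_of_lt hn, h₂⟩
  obtain ⟨h₁, h₂⟩ := stage_run hc x n h hn
  by_cases hx : x ∈ (g h).map (expandWord (nextHist τ h).length)
  · obtain ⟨t', h₃, h₄⟩ := h₁ hx
    refine ⟨true, t', h₃.mono (hN.trans hS), ⟨fun _ => ⟨0, ?_, hx⟩, fun _ => rfl⟩, h₄⟩
    rw [Function.iterate_one, count_false_nextHist]
    omega
  · have hpos := hc.pos h
    have hcf := count_false_nextHist (τ := τ) h
    have hct : (nextHist τ h).count true = h.count true + 1 := by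
      simp [nextHist, List.count_replicate]
    obtain ⟨ok, t', h₃, h₄, h₅⟩ := ih (n.drop (τ h)).length (by simp; omega) (n.drop (τ h))
      (nextHist τ h) (by omega) (by rw [List.length_drop, hcf]; omega) rfl
    refine ⟨ok, t', ((h₂ hx).trans h₃).mono ?_, ?_, h₅⟩
    · calc _ ≤ S + ((n.drop (τ h)).length + 1) * S := Nat.add_le_add_right hN _
        _ = ((n.drop (τ h)).length + 2) * S := by ring
        _ ≤ _ := Nat.mul_le_mul_right _ (by simp; omega)
    · rw [h₄, accepts_iff_of_notMem hn hx, List.length_drop]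

end

/-! ### Clearing the stacks -/

/-- The halting configuration with a given answer. -/
def finalCfg (c : ToPartrec.Code) (ok : Bool) : TM2.Cfg Sym (Lab c) Reg :=
  ⟨none, { mv := none, ok := true }, { out := [ok] : Tapes }.fn⟩

theorem clear_done (ok : Bool) (t : Tapes) (hn : totalSize t.fn = 0) :
    TM2.step (program c) (conf c .clear ok t) = some (finalCfg c ok) := by
  rw [totalSize_tapes] at hn
  obtain ⟨h₁, h₂, h₃, h₄, h₅, h₆, h₇, h₈, h₉, h₁₀, h₁₁⟩ : t.todo = [] ∧ t.done = [] ∧ t.clk = [] ∧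
      t.hist = [] ∧ t.aux = [] ∧ t.mach .main = [] ∧ t.mach .rev = [] ∧ t.mach .aux = [] ∧
      t.mach .stack = [] ∧ t.inp = [] ∧ t.out = [] := by
    simp only [← List.length_eq_zero_iff]; omega
  have h : (fun _ => [] : K' → List Γ') = Function.update (Function.update (Function.update
      (Function.update t.mach .main []) .rev []) .aux []) .stack [] := by
    funext k; cases k <;> simp
  simp [finalCfg, conf, program, h₁, h₂, h₃, h₄, h₅, h₆, h₇, h₈, h₉, h₁₀, h₁₁, h]

theorem clear_step (ok : Bool) (t : Tapes) (hinp : t.inp = []) (hout : t.out = [])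
    (hn : totalSize t.fn ≠ 0) :
    TM2.step (program c) (conf c .clear ok t) = some (conf c .clear ok { t with
      todo := t.todo.tail, done := t.done.tail, clk := t.clk.tail, hist := t.hist.tail
      aux := t.aux.tail, mach := fun k => (t.mach k).tail }) := by
  have h : (fun k => (t.mach k).tail : K' → List Γ') = Function.update (Function.update
      (Function.update (Function.update t.mach .main (t.mach .main).tail) .rev (t.mach .rev).tail)
      .aux (t.mach .aux).tail) .stack (t.mach .stack).tail := by
    funext k; cases k <;> simp
  rw [totalSize_tapes, hinp, hout] at hn
  have : (t.todo.head?.isSome || t.done.head?.isSome || t.clk.head?.isSome ||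
      t.hist.head?.isSome || t.aux.head?.isSome || (t.mach .main).head?.isSome ||
      (t.mach .rev).head?.isSome || (t.mach .aux).head?.isSome ||
      (t.mach .stack).head?.isSome) = true := by
    by_contra hb
    simp only [Bool.not_eq_true, Bool.or_eq_false_iff, Option.isSome_eq_false_iff,
      Option.isNone_iff_eq_none, List.head?_eq_none_iff] at hb
    simp [hb] at hn
  rw [h]
  simp only [conf, program, jump, Reg.tidy, TM2.step, TM2.stepAux, fn_todo, fn_done, fn_clk,
    fn_hist, fn_aux, fn_mach, update_todo, update_done, update_clk, update_hist, update_aux,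
    update_mach, Bool.false_or]
  simp [this]

theorem clear_loop (ok : Bool) (n : ℕ) (t : Tapes) (hinp : t.inp = []) (hout : t.out = [])
    (hn : totalSize t.fn ≤ n) :
    Within (TM2.step (program c)) (n + 1) (conf c .clear ok t) (finalCfg c ok) := by
  induction n generalizing t with
  | zero => exact Within.single (clear_done ok t (Nat.le_zero.1 hn))
  | succ n ih =>
    by_cases h : totalSize t.fn = 0
    · exact (Within.single (clear_done ok t h)).mono (by omega)
    · refine Within.head (clear_step ok t hinp hout h) (ih _ hinp hout ?_)
      rw [totalSize_tapes] at hn h ⊢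
      simp only [hinp, hout, List.length_nil, List.length_tail] at hn h ⊢
      omega

/-! ### The running time -/

/-- A bound for the running time before the stacks are cleared. -/
def runBound (G T : ℕ) : ℕ := T + 1 + (T + 1) * stageBound G (4 * T)

/-- A bound for the running time. -/
def timeBound (G T : ℕ) : ℕ := runBound G T + (T + runBound G T * G + 1)

theorem exists_polynomial (G : ℕ) : ∃ p : Polynomial ℕ, ∀ T, p.eval T = timeBound G T := by
  let S : Polynomial ℕ :=
    (2 * (4 * .X) + 3) + ((4 * .X) + (2 * (4 * .X) + 3) * (G : Polynomial ℕ)) * (3 * (4 * .X) + 7) + 1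
  let R : Polynomial ℕ := .X + 1 + (.X + 1) * S
  refine ⟨R + (.X + R * (G : Polynomial ℕ) + 1), fun T => ?_⟩
  simp [timeBound, runBound, stageBound, R, S]

theorem machine_run {g : List Bool → List (List (Bool × Bool))} {τ : List Bool → ℕ}
    (hc : Computes c g τ) (w : List Letter) :
    ∃ ok, Within (TM2.step (program c)) (timeBound (growth (program c)) w.length)
      (conf c .init true { inp := w }) (finalCfg c ok) ∧
      (ok = true ↔ Accepts g τ w.length [] (w.filter isData).reverse) := by
  have h₁ := init_loop (c := c) true w { inp := w } rfl
  obtain ⟨ok, t', h₂, h₃, h₄, h₅⟩ := run_stages hc (w.filter isData).reverse (4 * w.length)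
    (List.replicate w.length ()) [] le_rfl (by
      have := List.length_filter_le isData w
      simp; omega)
  have h₆ : Within (TM2.step (program c)) (runBound (growth (program c)) w.length)
      (conf c .init true { inp := w }) (conf c .clear ok t') := by
    simp only [List.append_nil] at h₁
    refine (h₁.trans h₂).mono ?_
    simp [runBound]
  have h₇ := totalSize_le_of_within _ h₆
  refine ⟨ok, h₆.trans (clear_loop ok _ t' h₄ h₅ (h₇.trans ?_)), by simpa using h₃⟩
  simp [conf, totalSize_tapes]

theorem exists_polyTime {g : List Bool → List (List (Bool × Bool))} {τ : List Bool → ℕ}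
    (hc : Computes c g τ) {α : Type} (ea : α → List Letter) (f : α → BinString)
    (hf : ∀ a (ok : Bool), (ok = true ↔ Accepts g τ (ea a).length [] ((ea a).filter isData).reverse) →
      f a = [ok]) :
    Nonempty (TM2ComputableInPolyTime ea (id : BinString → List Bool) f) := by
  obtain ⟨p, hp⟩ := exists_polynomial (growth (program c))
  refine ⟨{ tm := machine c, inputAlphabet := Equiv.refl Letter, outputAlphabet := Equiv.refl Bool,
            time := p, outputsFun := fun a => Nonempty.some ?_ }⟩
  obtain ⟨ok, ⟨m, hm, h₁⟩, h₂⟩ := machine_run hc (ea a)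
  rw [hf a ok h₂]
  refine ⟨⟨⟨m, ?_⟩, by rw [hp]; exact hm⟩⟩
  have h₃ := h₁.iterate
  have e₁ : initList (machine c) ((ea a).map (Equiv.refl Letter).invFun) =
      conf c .init true { inp := ea a } := by
    have : (ea a).map (Equiv.refl Letter).invFun = ea a := List.map_id _
    refine (congrArg (initList (machine c)) this).trans ?_
    unfold initList conf
    congr 1
    funext k
    cases k <;> rfl
  have e₂ : haltList (machine c) ([ok].map (Equiv.refl Bool).invFun) = finalCfg c ok := by
    unfold haltList finalCfg
    congr 1
    funext k
    cases k <;> rfl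
  refine Eq.trans ?_ (h₃.trans (congrArg some e₂.symm))
  exact congrArg (fun x => (flip bind (TM2.step (program c)))^[m] (some x)) e₁

/-! ### Computable functions are computed by the simulated machine -/

theorem number_cons (b : Bool) (h : List Bool) : number (b :: h) = 2 * number h + b.toNat := by
  cases b <;> simp [number, posNumber] <;> omega

theorem number_nil : number [] = 1 := rfl

theorem number_pos (h : List Bool) : 0 < number h := PosNum.cast_pos _

theorem number_injective : Function.Injective number := by
  intro h
  induction h with
  | nil =>
    rintro (_ | ⟨b, h'⟩) e
    · rfl
    · have := number_pos h'
      rw [number_cons, number_nil] at e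
      omega
  | cons b h ih =>
    rintro (_ | ⟨b', h'⟩) e
    · have := number_pos h
      rw [number_cons, number_nil] at e
      omega
    · rw [number_cons, number_cons] at e
      have hb : b = b' := by
        cases b <;> cases b' <;> simp at e ⊢ <;> omega
      subst hb
      rw [ih (show number h = number h' by omega)]

theorem number_primrec : Primrec number := by
  have : Primrec fun h : List Bool => h.foldr (fun b n => 2 * n + b.toNat) 1 := by
    refine Primrec.list_foldr (h := fun _ p => 2 * p.2 + Bool.toNat p.1) Primrec.id (Primrec.const 1) ?_
    refine Primrec.nat_add.comp (Primrec.nat_mul.comp (Primrec.const 2) (Primrec.snd.comp Primrec.snd)) ?_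
    exact (Primrec.dom_finite Bool.toNat).comp (Primrec.fst.comp Primrec.snd)
  refine this.of_eq fun h => ?_
  induction h with
  | nil => rfl
  | cons b h ih => rw [number_cons, List.foldr_cons, ih]

theorem symBits_primrec : Primrec symBits :=
  Primrec.list_flatMap Primrec.id <| Primrec.list_cons.comp (Primrec.fst.comp Primrec.snd) <|
    Primrec.list_cons.comp (Primrec.snd.comp Primrec.snd) (Primrec.const [false])

theorem tableBits_primrec : Primrec tableBits :=
  Primrec.list_flatMap Primrec.id <|
    Primrec.list_append.comp (symBits_primrec.comp Primrec.snd) (Primrec.const [false, false, true])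

/-- The code is found for `g`, and only then is `τ` read off from the code. To pass to functions on
numbers, the history is recovered from its number by an unbounded search. -/
theorem exists_computes {g : List Bool → List (List (Bool × Bool))} (hg : Computable g) :
    ∃ c τ, Computes c g τ := by
  let dec : ℕ → List Bool := fun k => (Encodable.decode k).getD []
  have hdec : Computable dec := Computable.option_getD Computable.decode (Computable.const [])
  let f : ℕ →. ℕ := fun m => (Nat.rfind fun k => Part.some (decide (number (dec k) = m))).map
    fun k => number (tableBits (g (dec k)))
  have hf : Partrec f := by
    refine Partrec.map (Partrec.rfind ?_) ?_
    · exact (Computable₂.comp (Primrec.eq.decide.to_comp) (number_primrec.to_comp.comp (hdec.comp Computable.snd))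
        Computable.fst).partrec
    · exact number_primrec.to_comp.comp (tableBits_primrec.to_comp.comp
        (hg.comp (hdec.comp Computable.snd)))
  have hf' : ∀ h, number (tableBits (g h)) ∈ f (number h) := by
    intro h
    have hdom : ∃ k, number (dec k) = number h := ⟨Encodable.encode h, by simp [dec]⟩
    have : (Nat.rfind fun k => Part.some (decide (number (dec k) = number h))).Dom := by
      obtain ⟨k, hk⟩ := hdom
      refine Nat.rfind_dom.2 ?_
      exact ⟨k, by simpa using hk, fun _ => trivial⟩
    obtain ⟨k, hk⟩ := Part.dom_iff_mem.1 this
    have hk' : number (dec k) = number h := by simpa using Nat.rfind_spec hk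
    refine Part.mem_map_iff _ |>.2 ⟨k, hk, ?_⟩
    rw [number_injective hk']
  obtain ⟨c, hc⟩ := ToPartrec.Code.exists_code (Nat.Partrec'.part_iff₁.2 hf)
  have key : ∀ h, ∃ n, 0 < n ∧ StepsTo (TM2.step tr) n (init c [number h])
      (halt [number (tableBits (g h))]) := by
    intro h
    have h₁ := hc ⟨[number h], rfl⟩
    have h₂ : halt [number (tableBits (g h))] ∈ StateTransition.eval (TM2.step tr) (init c [number h]) := by
      rw [tr_eval]
      refine (Part.mem_map_iff _).2 ⟨[number (tableBits (g h))], ?_, rfl⟩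
      exact h₁ ▸ (Part.mem_map_iff _).2 ⟨_, hf' h, rfl⟩
    obtain ⟨n, hn⟩ := StepsTo.of_reflTransGen (StateTransition.mem_eval.1 h₂).1
    refine ⟨n, Nat.pos_of_ne_zero ?_, hn⟩
    -- Zero steps would identify the initial configuration, which has a label, with the halting one,
    -- which has none.
    rintro rfl
    generalize hx : init c [number h] = x at hn
    generalize hy : halt [number (tableBits (g h))] = y at hn
    cases hn
    rw [← hy] at hx
    simpa [init, halt] using congrArg TM2.Cfg.l hx
  choose τ hτ using key
  exact ⟨c, τ, fun h => (hτ h).1, fun h => (hτ h).2⟩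

end ClockedMachine

/-! ### Naming the elements of an injective prefix tree by binary strings. -/

namespace PrefixTree

open ClockedMachine PTimeAlgebra

/-! ### Computable functions on lists -/

section Computability

variable {α β σ : Type*} [Primcodable α] [Primcodable β] [Primcodable σ]

/-- Recursion on the number of entries processed, each entry being looked up by its index; the
default for indices past the end is never used. -/
theorem computable_foldl {f : α → List β} {g : α → σ} {h : α → σ × β → σ} (hf : Computable f)
    (hg : Computable g) (hh : Computable₂ h) :
    Computable fun a => (f a).foldl (fun s b => h a (s, b)) (g a) := by
  have hstep : Computable₂ fun (a : α) (p : ℕ × σ) =>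
      Option.casesOn (motive := fun _ => σ) ((f a)[p.1]?) p.2 fun b => h a (p.2, b) := by
    refine Computable.option_casesOn ?_ (Computable.snd.comp Computable.snd) ?_
    · exact Computable.list_getElem?.comp (hf.comp Computable.fst)
        (Computable.fst.comp Computable.snd)
    · exact hh.comp (Computable.fst.comp Computable.fst)
        (Computable.pair (Computable.snd.comp (Computable.snd.comp Computable.fst)) Computable.snd)
  have := Computable.nat_rec (Computable.list_length.comp hf) hg hstep
  refine this.of_eq fun a => ?_
  suffices H : ∀ n, n ≤ (f a).length →
      (Nat.rec (g a) (fun i s => Option.casesOn (motive := fun _ => σ) ((f a)[i]?) s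
        fun b => h a (s, b)) n : σ) = ((f a).take n).foldl (fun s b => h a (s, b)) (g a) by
    rw [H _ le_rfl, List.take_length]
  intro n hn
  induction n with
  | zero => simp
  | succ n ih =>
    have hlt : n < (f a).length := hn
    have e : (f a)[n]? = some (f a)[n] := List.getElem?_eq_getElem hlt
    rw [List.take_add_one, e]
    simp only [Option.toList_some, List.foldl_append, List.foldl_cons, List.foldl_nil]
    rw [← ih hlt.le]
    show (Option.casesOn (motive := fun _ => σ) ((f a)[n]?) _ _ : σ) = _
    rw [e]

theorem computable_foldr {f : α → List β} {g : α → σ} {h : α → β × σ → σ} (hf : Computable f)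
    (hg : Computable g) (hh : Computable₂ h) :
    Computable fun a => (f a).foldr (fun b s => h a (b, s)) (g a) := by
  refine (computable_foldl (h := fun a p => h a (p.2, p.1)) (Computable.list_reverse.comp hf) hg
    (hh.comp Computable.fst (Computable.pair (Computable.snd.comp Computable.snd)
      (Computable.fst.comp Computable.snd)))).of_eq fun a => ?_
  rw [List.foldl_reverse]

theorem primrec_mem : PrimrecRel fun (x : α) (l : List α) => x ∈ l := by
  refine ((PrimrecRel.exists_mem_list (Primrec.eq (α := α))).comp Primrec.snd Primrec.fst).of_eq ?_
  simp

end Computability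

/-! ### The naming process -/

/-- An element with its name: a list of bits, preceded, if the flag is set, by a block of letters
`1` whose length is fixed at the end of the stage. -/
abbrev Entry : Type := ℕ × Bool × List Bool

/-- The string which is considered as a short name at stage `k`. -/
def stringAt (k : ℕ) : List Bool := (Encodable.decode k.unpair.1).getD []

/-- The name of the second new element of a path at stage `k`. -/
def shortName (k : ℕ) (A : List (ℕ × List Bool)) : Bool × List Bool :=
  -- The fallback is a block followed by two zeros. The bound `k` on the length keeps the short
  -- string apart from the block names of this stage, as `k < t`.
  bif decide (stringAt k ∈ A.map Prod.snd) || decide (k < (stringAt k).length) then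
    (true, [false, false]) else (false, stringAt k)

/-- The elements named before stage `k`, and the number `k` if it belongs to the domain. -/
def oldEntries (inD : ℕ → Bool) (k : ℕ) (A : List (ℕ × List Bool)) : List Entry :=
  bif inD k && !decide (k ∈ A.map Prod.fst) then
    (k, true, []) :: A.map (fun p => (p.1, false, p.2)) else A.map (fun p => (p.1, false, p.2))

/-- The elements named after stage `k`. -/
def entries (inD : ℕ → Bool) (F : List ℕ → ℕ × ℕ) (k : ℕ) (A : List (ℕ × List Bool)) :
    List Entry :=
  -- `F` must avoid `k` too, which may itself be named in this stage; hence it is applied to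
  -- `oldEntries`.
  ((F ((oldEntries inD k A).map Prod.fst)).2, shortName k A) ::
    ((F ((oldEntries inD k A).map Prod.fst)).1, true, [false]) :: oldEntries inD k A

/-- Fix the length of the block of letters `1` in a name. -/
def settle (t : ℕ) (e : Entry) : ℕ × List Bool :=
  (e.1, (bif e.2.1 then List.replicate t true else []) ++ e.2.2)

/-- The elements named so far, with their names, as a function of the history. -/
def state (inD : ℕ → Bool) (F : List ℕ → ℕ × ℕ) : List Bool → List (ℕ × List Bool)
  | [] => []
  | false :: h => state inD F h
  -- `h.length + 1` is the length of `true :: h`, the history by which the machine expands the block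
  -- symbol after this stage.
  | true :: h => (entries inD F (h.count true) (state inD F h)).map (settle (h.length + 1))

/-- All lists of length at most `n` of elements of `B`. -/
def listsUpTo {α : Type*} (B : List α) : ℕ → List (List α)
  | 0 => [[]]
  | n + 1 => [] :: (listsUpTo B n).flatMap fun l => B.map fun b => b :: l

theorem mem_listsUpTo {α : Type*} {B : List α} {n : ℕ} {l : List α} :
    l ∈ listsUpTo B n ↔ l.length ≤ n ∧ ∀ x ∈ l, x ∈ B := by
  induction n generalizing l with
  | zero => cases l <;> simp [listsUpTo]
  | succ n ih =>
    cases l with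
    | nil => simp [listsUpTo]
    | cons b l =>
      simp only [listsUpTo, List.mem_cons, reduceCtorEq, List.mem_flatMap, List.mem_map,
        List.cons.injEq, false_or, List.length_cons, Nat.add_le_add_iff_right, forall_eq_or_imp]
      constructor
      · rintro ⟨l', h, b', hb, rfl, rfl⟩
        exact ⟨(ih.1 h).1, hb, (ih.1 h).2⟩
      · rintro ⟨h₁, hb, h₂⟩
        exact ⟨l, ih.2 ⟨h₁, h₂⟩, b, hb, rfl, rfl⟩

/-- The symbols of a name. -/
def nameSymbols (e : Bool × List Bool) : List (Bool × Bool) :=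
  (bif e.1 then [(true, true)] else []) ++ e.2.map fun b => (b, false)

/-- The symbols of a tuple of names, in reverse order. -/
def tupleSymbols (l : List Entry) : List (Bool × Bool) :=
  -- `(false, true)` codes the separator `d`; `tail` drops the one before the first name.
  (l.flatMap fun e => (false, true) :: nameSymbols e.2).tail.reverse

/-- The table of all paths among the elements named so far. -/
def pathTable (R : List ℕ → Bool) (B : List Entry) : List (List (Bool × Bool)) :=
  (listsUpTo B B.length).foldr
    (fun l s => bif R (l.map Prod.fst) then tupleSymbols l :: s else s) []

theorem mem_pathTable {R : List ℕ → Bool} {B : List Entry} {w : List (Bool × Bool)} :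
    w ∈ pathTable R B ↔ ∃ l : List Entry, l.length ≤ B.length ∧ (∀ e ∈ l, e ∈ B) ∧
      R (l.map Prod.fst) = true ∧ tupleSymbols l = w := by
  unfold pathTable
  have : ∀ L : List (List Entry), w ∈ L.foldr
      (fun l s => bif R (l.map Prod.fst) then tupleSymbols l :: s else s) [] ↔
      ∃ l ∈ L, R (l.map Prod.fst) = true ∧ tupleSymbols l = w := by
    intro L
    induction L with
    | nil => simp
    | cons l L ih =>
      cases h : R (l.map Prod.fst) <;> simp [h, ih, @eq_comm _ w]
  rw [this]
  simp only [mem_listsUpTo, and_assoc]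

/-- The table of paths as a function of the history. -/
def table (inD : ℕ → Bool) (R : List ℕ → Bool) (F : List ℕ → ℕ × ℕ) (h : List Bool) :
    List (List (Bool × Bool)) :=
  pathTable R (entries inD F (h.count true) (state inD F h))

/-! ### The naming process is computable -/

theorem stringAt_primrec : Primrec stringAt :=
  Primrec.option_getD.comp (Primrec.decode.comp (Primrec.fst.comp Primrec.unpair)) (Primrec.const [])

theorem shortName_primrec : Primrec₂ shortName := by
  refine Primrec.cond (Primrec.or.comp ?_ ?_) (Primrec.const _)
    (Primrec.pair (Primrec.const _) (stringAt_primrec.comp Primrec.fst))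
  · exact primrec_mem.decide.comp (stringAt_primrec.comp Primrec.fst)
      (Primrec.list_map Primrec.snd (Primrec.snd.comp Primrec.snd))
  · exact Primrec.nat_lt.decide.comp Primrec.fst
      (Primrec.list_length.comp (stringAt_primrec.comp Primrec.fst))

theorem replicate_primrec {α : Type*} [Primcodable α] (a : α) :
    Primrec fun n => List.replicate n a :=
  (Primrec.list_map Primrec.list_range (Primrec.const a).to₂).of_eq fun n => by
    rw [List.map_const', List.length_range]

theorem settle_primrec : Primrec₂ settle :=
  Primrec.pair (Primrec.fst.comp Primrec.snd) <| Primrec.list_append.comp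
    (Primrec.cond (Primrec.fst.comp (Primrec.snd.comp Primrec.snd))
      ((replicate_primrec true).comp Primrec.fst) (Primrec.const []))
    (Primrec.snd.comp (Primrec.snd.comp Primrec.snd))

theorem listsUpTo_primrec {α : Type*} [Primcodable α] : Primrec₂ (listsUpTo (α := α)) := by
  have : Primrec₂ fun (B : List α) (n : ℕ) => (Nat.rec [[]] (fun _ ih =>
      [] :: ih.flatMap fun l => B.map fun b => b :: l) n : List (List α)) := by
    refine Primrec.nat_rec (f := fun _ => [[]]) (g := fun (B : List α) (p : ℕ × List (List α)) =>
      [] :: p.2.flatMap fun l => B.map fun b => b :: l) (Primrec.const _) ?_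
    refine Primrec.list_cons.comp (Primrec.const ([] : List α)) ?_
    refine Primrec.list_flatMap (Primrec.snd.comp Primrec.snd) ?_
    refine Primrec.list_map (Primrec.fst.comp Primrec.fst) ?_
    exact Primrec.list_cons.comp Primrec.snd (Primrec.snd.comp Primrec.fst)
  refine this.of_eq fun B n => ?_
  induction n with
  | zero => rfl
  | succ n ih => rw [listsUpTo, ← ih]

theorem nameSymbols_primrec : Primrec nameSymbols :=
  Primrec.list_append.comp
    (Primrec.cond Primrec.fst (Primrec.const _) (Primrec.const _))
    (Primrec.list_map Primrec.snd (Primrec.pair Primrec.snd (Primrec.const false)))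

theorem tupleSymbols_primrec : Primrec tupleSymbols :=
  Primrec.list_reverse.comp <| Primrec.list_tail.comp <| Primrec.list_flatMap Primrec.id <|
    Primrec.list_cons.comp (Primrec.const _)
      (nameSymbols_primrec.comp (Primrec.snd.comp Primrec.snd))

section

variable {inD : ℕ → Bool} {R : List ℕ → Bool} {F : List ℕ → ℕ × ℕ}

theorem oldEntries_computable (hD : Computable inD) : Computable₂ (oldEntries inD) := by
  have h : Computable fun p : ℕ × List (ℕ × List Bool) =>
      p.2.map (fun q => ((q.1, false, q.2) : Entry)) :=
    have hg : Primrec₂ fun (_ : ℕ × List (ℕ × List Bool)) (q : ℕ × List Bool) =>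
        ((q.1, false, q.2) : Entry) :=
      Primrec.pair (Primrec.fst.comp Primrec.snd) (Primrec.pair (Primrec.const false)
        (Primrec.snd.comp Primrec.snd))
    (Primrec.list_map Primrec.snd hg).to_comp
  refine Computable.cond ?_ (Computable.list_cons.comp
    (Computable.pair Computable.fst (Computable.const _)) h) h
  refine Primrec.and.to_comp.comp (hD.comp Computable.fst) (Primrec.not.comp ?_).to_comp
  exact primrec_mem.decide.comp Primrec.fst
    (Primrec.list_map Primrec.snd (Primrec.fst.comp Primrec.snd))

theorem entries_computable (hD : Computable inD) (hF : Computable F) :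
    Computable₂ (entries inD F) := by
  have hold := oldEntries_computable hD
  have h : Computable fun p : ℕ × List (ℕ × List Bool) =>
      F ((oldEntries inD p.1 p.2).map Prod.fst) :=
    have hg : Primrec₂ fun (_ : List Entry) (e : Entry) => e.1 := Primrec.fst.comp Primrec.snd
    hF.comp ((Primrec.list_map Primrec.id hg).to_comp.comp hold)
  exact Computable.list_cons.comp
    (Computable.pair (Computable.snd.comp h) shortName_primrec.to_comp)
    (Computable.list_cons.comp
      (Computable.pair (Computable.fst.comp h) (Computable.const _)) hold)

theorem state_computable (hD : Computable inD) (hF : Computable F) :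
    Computable fun h : List Bool => (h.count true, state inD F h) := by
  -- The fold also carries the length of the history, which `settle` needs.
  let step : List Bool → Bool × ℕ × ℕ × List (ℕ × List Bool) → ℕ × ℕ × List (ℕ × List Bool) :=
    fun _ p => bif p.1 then
      (p.2.1 + 1, p.2.2.1 + 1, (entries inD F p.2.1 p.2.2.2).map (settle (p.2.2.1 + 1)))
      else (p.2.1, p.2.2.1 + 1, p.2.2.2)
  have hlen : Computable fun q : List Bool × Bool × ℕ × ℕ × List (ℕ × List Bool) =>
      q.2.2.2.1 + 1 :=
    Computable.succ.comp (Computable.fst.comp (Computable.snd.comp (Computable.snd.comp Computable.snd)))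
  have hcnt : Computable fun q : List Bool × Bool × ℕ × ℕ × List (ℕ × List Bool) => q.2.2.1 :=
    Computable.fst.comp (Computable.snd.comp Computable.snd)
  have hst : Computable fun q : List Bool × Bool × ℕ × ℕ × List (ℕ × List Bool) => q.2.2.2.2 :=
    Computable.snd.comp (Computable.snd.comp (Computable.snd.comp Computable.snd))
  have hstep : Computable₂ step := by
    refine Computable.cond (Computable.fst.comp Computable.snd) ?_
      (Computable.pair hcnt (Computable.pair hlen hst))
    refine Computable.pair (Computable.succ.comp hcnt) (Computable.pair hlen ?_)
    have : Computable fun p : List Entry × ℕ => p.1.map (settle p.2) :=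
      (Primrec.list_map (g := fun p e => settle p.2 e) Primrec.fst
        (settle_primrec.comp (Primrec.snd.comp Primrec.fst) Primrec.snd)).to_comp
    exact this.comp (Computable.pair ((entries_computable hD hF).comp hcnt hst) hlen)
  have := computable_foldr (f := fun h : List Bool => h) (g := fun _ => (0, 0, [])) Computable.id
    (Computable.const _) hstep
  refine (Computable.pair (Computable.fst.comp this)
    (Computable.snd.comp (Computable.snd.comp this))).of_eq fun h => ?_
  have key : h.foldr (fun b s => step h (b, s)) (0, 0, []) =
      (h.count true, h.length, state inD F h) := by
    have : ∀ h', h'.foldr (fun b s => step h (b, s)) (0, 0, []) =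
        (h'.count true, h'.length, state inD F h') := by
      intro h'
      induction h' with
      | nil => rfl
      | cons b h' ih => cases b <;> simp [ih, step, state]
    exact this h
  rw [key]

theorem table_computable (hD : Computable inD) (hR : Computable R) (hF : Computable F) :
    Computable (table inD R F) := by
  have h₁ : Computable (pathTable R) := by
    refine computable_foldr (f := fun B : List Entry => listsUpTo B B.length)
      (h := fun _ p => bif R (p.1.map Prod.fst) then tupleSymbols p.1 :: p.2 else p.2) ?_ (Computable.const []) ?_
    · exact (listsUpTo_primrec.comp (Primrec.id (α := List Entry))
        (Primrec.list_length (α := Entry))).to_comp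
    · refine Computable.cond (hR.comp ?_) (Computable.list_cons.comp
        (tupleSymbols_primrec.to_comp.comp (Computable.fst.comp Computable.snd))
        (Computable.snd.comp Computable.snd)) (Computable.snd.comp Computable.snd)
      have hg : Primrec₂ fun (_ : List Entry × List Entry × List (List (Bool × Bool)))
          (e : Entry) => e.1 := Primrec.fst.comp Primrec.snd
      exact (Primrec.list_map (Primrec.fst.comp Primrec.snd) hg).to_comp
  have h₂ := state_computable hD hF
  exact h₁.comp ((entries_computable hD hF).comp (Computable.fst.comp h₂) (Computable.snd.comp h₂))

end

/-! ### Computable injective prefix trees -/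

/-- `R` is the set of paths of an injective prefix tree of unbounded depth on the domain `inD`. -/
structure IsTree (inD : ℕ → Bool) (R : List ℕ → Bool) : Prop where
  dom : ∀ l, R l = true → ∀ x ∈ l, inD x = true
  ne_nil : ∀ l, R l = true → l ≠ []
  pref : ∀ l l', R l = true → l' ≠ [] → l' <+: l → R l' = true
  inj : ∀ l l' a, R (l ++ [a]) = true → R (l' ++ [a]) = true → l = l'
  depth : ∀ n, ∃ l, R l = true ∧ n ≤ l.length

namespace IsTree

variable {inD : ℕ → Bool} {R : List ℕ → Bool} (hT : IsTree inD R)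

include hT

theorem eq_of_append {l l' m m' : List ℕ} {a : ℕ} (h : R (l ++ a :: m) = true)
    (h' : R (l' ++ a :: m') = true) : l = l' :=
  hT.inj l l' a (hT.pref _ _ h (by simp) ⟨m, by simp⟩) (hT.pref _ _ h' (by simp) ⟨m', by simp⟩)

/-- Two occurrences of an element would end two paths of different lengths. -/
theorem nodup {l : List ℕ} (h : R l = true) : l.Nodup := by
  rw [List.nodup_iff_sublist]
  intro a ha
  obtain ⟨l₁, l₂, rfl, h₁, h₂⟩ := List.cons_sublist_iff.1 ha
  obtain ⟨s, t, rfl⟩ := List.append_of_mem h₁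
  obtain ⟨u, v, rfl⟩ := List.append_of_mem (List.singleton_sublist.1 h₂)
  have e := hT.eq_of_append (l := s) (l' := s ++ a :: t ++ u) (m := t ++ (u ++ a :: v)) (m' := v)
    (a := a) (by simpa using h) (by simpa using h)
  have := congrArg List.length e
  simp at this

/-- A path has no repetitions, so at most `u.length` of its elements lie in `u`; it suffices to take
one of length at least `u.length + 2`. -/
theorem exists_two_new (u : List ℕ) :
    ∃ l, R l = true ∧ 2 ≤ (l.filter fun a => !decide (a ∈ u)).length := by
  obtain ⟨l, hl, hlen⟩ := hT.depth (u.length + 2)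
  refine ⟨l, hl, ?_⟩
  have h₁ : (l.filter fun a => decide (a ∈ u)).length ≤ u.length := by
    refine (List.subperm_of_subset ((hT.nodup hl).filter _) ?_).length_le
    intro a ha
    simpa using (List.mem_filter.1 ha).2
  have h₂ := List.length_eq_length_filter_add (l := l) fun a => decide (a ∈ u)
  omega

end IsTree

/-- `F` chooses, given a finite set `u`, two elements outside `u` such that the first one lies on
every path through the second one. -/
def Chooses (inD : ℕ → Bool) (R : List ℕ → Bool) (F : List ℕ → ℕ × ℕ) : Prop :=
  ∀ u, (F u).1 ∉ u ∧ (F u).2 ∉ u ∧ (F u).1 ≠ (F u).2 ∧ inD (F u).1 = true ∧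
    inD (F u).2 = true ∧ ∀ l, R l = true → (F u).2 ∈ l → (F u).1 ∈ l

/-- Search for a path with two elements outside `u` and take the first two of them, `a` before `b`.
By injectivity all paths through `b` agree up to `b`, so all of them contain `a`. -/
theorem exists_chooses {inD : ℕ → Bool} {R : List ℕ → Bool} (hT : IsTree inD R)
    (hR : Computable R) : ∃ F, Computable F ∧ Chooses inD R F := by
  let dec : ℕ → List ℕ := fun k => (Encodable.decode k).getD []
  have hdec : Computable dec := Computable.option_getD Computable.decode (Computable.const [])
  let new : List ℕ → List ℕ → List ℕ := fun u l => l.filter fun a => !decide (a ∈ u)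
  have hnew : Primrec₂ new :=
    ((PrimrecRel.listFilter (R := fun (a : ℕ) (u : List ℕ) => a ∉ u) primrec_mem.not).comp
      Primrec.snd Primrec.fst).of_eq fun p => by simp [new]
  let p : List ℕ → ℕ → Bool := fun u n => R (dec n) && decide (2 ≤ (new u (dec n)).length)
  have hp : Computable₂ p := by
    refine Primrec.and.to_comp.comp (hR.comp (hdec.comp Computable.snd)) ?_
    exact Primrec.nat_le.decide.to_comp.comp (Computable.const 2) (Computable.list_length.comp
      (hnew.to_comp.comp Computable.fst (hdec.comp Computable.snd)))
  have hex : ∀ u, ∃ k, k ∈ Nat.rfind fun n => Part.some (p u n) := by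
    intro u
    obtain ⟨l, h₁, h₂⟩ := hT.exists_two_new u
    refine Part.dom_iff_mem.1 (Nat.rfind_dom.2 ⟨Encodable.encode l, ?_, fun _ => trivial⟩)
    simpa [p, dec, new, h₁] using h₂
  choose K hK using hex
  have hKc : Computable K := by
    have : Partrec fun u => Nat.rfind fun n => Part.some (p u n) := Partrec.rfind hp.partrec₂
    exact this.of_eq fun u => Part.eq_some_iff.2 (hK u)
  refine ⟨fun u => ((new u (dec (K u))).headI, (new u (dec (K u))).tail.headI), ?_, ?_⟩
  · have h : Computable fun u => new u (dec (K u)) :=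
      hnew.to_comp.comp Computable.id (hdec.comp hKc)
    exact Computable.pair (Primrec.list_headI.to_comp.comp h)
      (Primrec.list_headI.to_comp.comp (Primrec.list_tail.to_comp.comp h))
  · intro u
    have hspec : p u (K u) = true := by simpa using Nat.rfind_spec (hK u)
    obtain ⟨hRl, hlen⟩ : R (dec (K u)) = true ∧ 2 ≤ (new u (dec (K u))).length := by
      simpa [p] using hspec
    generalize hl : dec (K u) = l at hRl hlen
    obtain ⟨a, b, r, hr⟩ : ∃ a b r, new u l = a :: b :: r := by
      match h : new u l with
      | [] => simp [h] at hlen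
      | [_] => simp [h] at hlen
      | a :: b :: r => exact ⟨a, b, r, rfl⟩
    have e₁ : (new u (dec (K u))).headI = a := by rw [hl, hr]; rfl
    have e₂ : (new u (dec (K u))).tail.headI = b := by rw [hl, hr]; rfl
    simp only [e₁, e₂]
    have ha : a ∈ new u l := by simp [hr]
    have hb : b ∈ new u l := by simp [hr]
    have hnd : (new u l).Nodup := (hT.nodup hRl).filter _
    rw [hr] at hnd
    simp only [new, List.mem_filter, Bool.not_eq_true', decide_eq_false_iff_not] at ha hb
    refine ⟨ha.2, hb.2, fun hab => ?_, hT.dom _ hRl _ ha.1, hT.dom _ hRl _ hb.1, ?_⟩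
    · simp [hab] at hnd
    · intro l' hl' hbl'
      obtain ⟨s, t, rfl⟩ := List.append_of_mem hbl'
      have hsub : [a, b].Sublist l := (hr ▸ (List.Sublist.cons_cons a (List.Sublist.cons_cons b
        (List.nil_sublist r))) : [a, b].Sublist (new u l)).trans List.filter_sublist
      obtain ⟨l₁, l₂, rfl, h₁, h₂⟩ := List.cons_sublist_iff.1 hsub
      obtain ⟨v, w, rfl⟩ := List.append_of_mem (List.singleton_sublist.1 h₂)
      have e := hT.eq_of_append (l := l₁ ++ v) (by simpa using hRl) hl'
      rw [← e]
      simp [h₁]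

/-! ### Every element gets a name, and every string is a name -/

section

variable {inD : ℕ → Bool} {R : List ℕ → Bool} {F : List ℕ → ℕ × ℕ} {τ : List Bool → ℕ}

/-- The history at the beginning of stage `k`. -/
def hist (τ : List Bool → ℕ) (k : ℕ) : List Bool := (nextHist τ)^[k] []

/-- The elements named before stage `k`. -/
def named (inD : ℕ → Bool) (F : List ℕ → ℕ × ℕ) (τ : List Bool → ℕ) (k : ℕ) :
    List (ℕ × List Bool) :=
  state inD F (hist τ k)

/-- The entries at stage `k`. -/
def entriesAt (inD : ℕ → Bool) (F : List ℕ → ℕ × ℕ) (τ : List Bool → ℕ) (k : ℕ) : List Entry :=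
  entries inD F k (named inD F τ k)

theorem hist_succ (k : ℕ) : hist τ (k + 1) = nextHist τ (hist τ k) :=
  Function.iterate_succ_apply' _ _ _

theorem count_true_hist (k : ℕ) : (hist τ k).count true = k := by
  induction k with
  | zero => rfl
  | succ k ih => rw [hist_succ]; simp [nextHist, ih, List.count_replicate]

theorem length_hist_lt (k : ℕ) : (hist τ k).length < (hist τ (k + 1)).length := by
  rw [hist_succ]; simp [nextHist]

theorem lt_length_hist (k : ℕ) : k < (hist τ (k + 1)).length := by
  induction k with
  | zero => exact (Nat.zero_le _).trans_lt (length_hist_lt 0)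
  | succ k ih => have := length_hist_lt (τ := τ) (k + 1); omega

theorem named_succ (k : ℕ) : named inD F τ (k + 1) =
    (entriesAt inD F τ k).map (settle (hist τ (k + 1)).length) := by
  have h : ∀ (n : ℕ) (l : List Bool), state inD F (List.replicate n false ++ l) = state inD F l := by
    intro n l
    induction n with
    | zero => rfl
    | succ n ih => rw [List.replicate_succ, List.cons_append, state, ih]
  have hc : (List.replicate (τ (hist τ k)) false ++ hist τ k).count true = k := by
    rw [List.count_append, count_true_hist, List.count_replicate]; simp
  rw [named, hist_succ, nextHist, state, h, hc]
  rfl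

theorem mem_oldEntries {k : ℕ} {A : List (ℕ × List Bool)} {e : Entry} :
    e ∈ oldEntries inD k A ↔ (e.2.1 = false ∧ (e.1, e.2.2) ∈ A) ∨
      (e = (k, true, []) ∧ inD k = true ∧ k ∉ A.map Prod.fst) := by
  obtain ⟨d, b, s⟩ := e
  unfold oldEntries
  cases h : (inD k && !decide (k ∈ A.map Prod.fst))
  · have h' : ¬ (inD k = true ∧ k ∉ A.map Prod.fst) := by
      rintro ⟨h₁, h₂⟩
      simp [h₁] at h
      exact h₂ (by simpa using h)
    simp only [cond_false, h', and_false, or_false]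
    cases b <;> simp
  · have h' : inD k = true ∧ k ∉ A.map Prod.fst := by simpa using h
    simp only [cond_true, h']
    cases b <;> simp

theorem settle_fst (t : ℕ) (B : List Entry) : (B.map (settle t)).map Prod.fst = B.map Prod.fst := by
  simp [settle, Function.comp_def]

theorem mem_named_succ {k : ℕ} {a : ℕ × List Bool} (h : a ∈ named inD F τ k) :
    a ∈ named inD F τ (k + 1) := by
  rw [named_succ]
  refine List.mem_map.2 ⟨(a.1, false, a.2), ?_, by simp [settle]⟩
  exact List.mem_cons_of_mem _ (List.mem_cons_of_mem _ (mem_oldEntries.2 (Or.inl ⟨rfl, h⟩)))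

theorem mem_named_mono {k k' : ℕ} (hk : k ≤ k') {a : ℕ × List Bool} (h : a ∈ named inD F τ k) :
    a ∈ named inD F τ k' := by
  induction hk with
  | refl => exact h
  | step _ ih => exact mem_named_succ ih

theorem shortName_spec (k : ℕ) (A : List (ℕ × List Bool)) :
    shortName k A = (true, [false, false]) ∨
      (shortName k A = (false, stringAt k) ∧ stringAt k ∉ A.map Prod.snd ∧
        (stringAt k).length ≤ k) := by
  unfold shortName
  cases h : decide (stringAt k ∈ A.map Prod.snd) || decide (k < (stringAt k).length)
  · right
    rw [Bool.or_eq_false_iff, decide_eq_false_iff_not, decide_eq_false_iff_not, not_lt] at h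
    exact ⟨rfl, h⟩
  · exact Or.inl rfl

/-- The properties of the elements named before a stage. -/
structure IsNaming (inD : ℕ → Bool) (A : List (ℕ × List Bool)) (n : ℕ) : Prop where
  nodup_fst : (A.map Prod.fst).Nodup
  nodup_snd : (A.map Prod.snd).Nodup
  dom : ∀ a ∈ A, inD a.1 = true
  count_lt : ∀ a ∈ A, a.2.count true < n

/-- Names are told apart by counting letters `1`: older names have fewer than `t`, the block names
exactly `t`, and these differ in their number of zeros. A short name has length at most `k < t` and
was unused. -/
theorem isNaming_succ (hF : Chooses inD R F) {k t : ℕ} (hk : k < t) {A : List (ℕ × List Bool)}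
    (hA : IsNaming inD A t) {n : ℕ} (hn : t < n) :
    IsNaming inD ((entries inD F k A).map (settle t)) n := by
  have hlit : (A.map fun p => ((p.1, false, p.2) : Entry)).map (settle t) = A := by
    rw [List.map_map]
    exact (List.map_congr_left fun a _ => by simp [settle]).trans (List.map_id A)
  have hnotmem : ∀ w : List Bool, t ≤ w.count true → w ∉ A.map Prod.snd := by
    intro w hw hmem
    obtain ⟨a, ha, rfl⟩ := List.mem_map.1 hmem
    exact absurd (hA.count_lt a ha) (not_lt.2 hw)
  have hcount : ∀ s : List Bool, s.count true = 0 →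
      (List.replicate t true ++ s).count true = t := by
    intro s hs
    rw [List.count_append, hs, List.count_replicate_self, Nat.add_zero]
  have hold : ∃ C, (oldEntries inD k A).map (settle t) = C ∧ IsNaming inD C n ∧
      ∀ w ∈ C.map Prod.snd, w ∈ A.map Prod.snd ∨ w = List.replicate t true := by
    refine ⟨_, rfl, ?_⟩
    unfold oldEntries
    cases h : (inD k && !decide (k ∈ A.map Prod.fst))
    · rw [cond_false, hlit]
      exact ⟨⟨hA.1, hA.2, hA.3, fun a ha => (hA.4 a ha).trans hn⟩, fun w hw => Or.inl hw⟩
    · have h' : inD k = true ∧ k ∉ A.map Prod.fst := by simpa using h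
      have hs : settle t (k, true, []) = (k, List.replicate t true) := by simp [settle]
      rw [cond_true, List.map_cons, hlit, hs]
      refine ⟨⟨?_, ?_, ?_, ?_⟩, ?_⟩
      · exact List.nodup_cons.2 ⟨h'.2, hA.1⟩
      · exact List.nodup_cons.2 ⟨hnotmem _ (by simp), hA.2⟩
      · intro a ha
        rcases List.mem_cons.1 ha with rfl | ha
        exacts [h'.1, hA.3 a ha]
      · intro a ha
        rcases List.mem_cons.1 ha with rfl | ha
        exacts [by simpa using hn, (hA.4 a ha).trans hn]
      · intro w hw
        rcases List.mem_cons.1 hw with rfl | hw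
        exacts [Or.inr rfl, Or.inl hw]
  obtain ⟨C, hC, hCN, hCw⟩ := hold
  obtain ⟨h₁, h₂, h₃, h₄, h₅, -⟩ := hF ((oldEntries inD k A).map Prod.fst)
  have hCfst : (oldEntries inD k A).map Prod.fst = C.map Prod.fst := by rw [← hC, settle_fst]
  have hlong : ∀ s : List Bool, s.count true = 0 → s ≠ [] →
      List.replicate t true ++ s ∉ C.map Prod.snd := by
    intro s hs hne hmem
    rcases hCw _ hmem with h | h
    · exact hnotmem _ (hcount s hs).ge h
    · exact hne (by simpa using h)
  unfold entries
  generalize F ((oldEntries inD k A).map Prod.fst) = pq at *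
  rw [hCfst] at h₁ h₂
  rw [List.map_cons, List.map_cons, hC]
  have hp : settle t (pq.1, true, [false]) = (pq.1, List.replicate t true ++ [false]) := rfl
  rw [hp]
  obtain ⟨w, hw, hwC, hwp, hwn⟩ : ∃ w, settle t (pq.2, shortName k A) = (pq.2, w) ∧
      w ∉ C.map Prod.snd ∧ w ≠ List.replicate t true ++ [false] ∧ w.count true < n := by
    rcases shortName_spec k A with h | ⟨h, hA', hlen⟩
    · refine ⟨List.replicate t true ++ [false, false], by rw [h]; rfl, hlong _ rfl (by simp), ?_, ?_⟩
      · simp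
      · rw [hcount _ rfl]; exact hn
    · have hc : (stringAt k).count true < t := (List.count_le_length.trans hlen).trans_lt hk
      refine ⟨stringAt k, by rw [h]; rfl, fun hmem => ?_, ?_, hc.trans hn⟩
      · rcases hCw _ hmem with h | h
        · exact hA' h
        · rw [h] at hc; simp at hc
      · intro h
        rw [h, hcount _ rfl] at hc
        exact hc.false
  rw [hw]
  refine ⟨?_, ?_, ?_, ?_⟩
  · simp only [List.map_cons, List.nodup_cons, List.mem_cons, not_or]
    exact ⟨⟨fun h => h₃ h.symm, h₂⟩, h₁, hCN.1⟩
  · simp only [List.map_cons, List.nodup_cons, List.mem_cons, not_or]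
    exact ⟨⟨hwp, hwC⟩, hlong _ rfl (by simp), hCN.2⟩
  · intro a ha
    rcases List.mem_cons.1 ha with rfl | ha
    · exact h₅
    rcases List.mem_cons.1 ha with rfl | ha
    exacts [h₄, hCN.3 a ha]
  · intro a ha
    rcases List.mem_cons.1 ha with rfl | ha
    · exact hwn
    rcases List.mem_cons.1 ha with rfl | ha
    exacts [by rw [hcount _ rfl]; exact hn, hCN.4 a ha]

theorem exists_name {d : ℕ} (hd : inD d = true) : ∃ k w, (d, w) ∈ named inD F τ k := by
  by_cases h : d ∈ (named inD F τ d).map Prod.fst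
  · obtain ⟨a, ha, rfl⟩ := List.mem_map.1 h
    exact ⟨_, _, ha⟩
  · refine ⟨d + 1, (settle (hist τ (d + 1)).length (d, true, [])).2, ?_⟩
    rw [named_succ]
    refine List.mem_map.2 ⟨(d, true, []), ?_, rfl⟩
    exact List.mem_cons_of_mem _ (List.mem_cons_of_mem _ (mem_oldEntries.2 (Or.inr ⟨rfl, hd, h⟩)))

theorem exists_named (w : List Bool) : ∃ k d, (d, w) ∈ named inD F τ k := by
  -- The first component makes `w` the string considered at stage `k`; the second makes `k` large
  -- enough for `w` to pass the length test.
  set k := Nat.pair (Encodable.encode w) w.length with hk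
  have hs : stringAt k = w := by simp [stringAt, hk]
  by_cases h : w ∈ (named inD F τ k).map Prod.snd
  · obtain ⟨a, ha, rfl⟩ := List.mem_map.1 h
    exact ⟨_, _, ha⟩
  · have hlen : ¬ k < w.length := not_lt.2 (Nat.right_le_pair _ _)
    have : shortName k (named inD F τ k) = (false, w) := by simp [shortName, hs, h, hlen]
    refine ⟨k + 1, (F ((oldEntries inD k (named inD F τ k)).map Prod.fst)).2, ?_⟩
    rw [named_succ]
    refine List.mem_map.2 ⟨_, List.mem_cons_self, ?_⟩
    rw [this]
    rfl

variable (hF : Chooses inD R F)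

include hF

theorem isNaming_named (k : ℕ) : IsNaming inD (named inD F τ k) (hist τ (k + 1)).length := by
  induction k with
  | zero =>
    have : named inD F τ 0 = [] := rfl
    rw [this]
    exact ⟨by simp, by simp, by simp, by simp⟩
  | succ k ih =>
    rw [named_succ]
    exact isNaming_succ hF (lt_length_hist k) ih (length_hist_lt (k + 1))

theorem named_fst_unique {k k' d : ℕ} {w w' : List Bool} (h : (d, w) ∈ named inD F τ k)
    (h' : (d, w') ∈ named inD F τ k') : w = w' := by
  have h₁ := mem_named_mono (le_max_left k k') h
  have h₂ := mem_named_mono (le_max_right k k') h'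
  have := List.inj_on_of_nodup_map (isNaming_named hF (max k k')).nodup_fst h₁ h₂ rfl
  exact congrArg Prod.snd this

theorem named_snd_unique {k k' d d' : ℕ} {w : List Bool} (h : (d, w) ∈ named inD F τ k)
    (h' : (d', w) ∈ named inD F τ k') : d = d' := by
  have h₁ := mem_named_mono (le_max_left k k') h
  have h₂ := mem_named_mono (le_max_right k k') h'
  have := List.inj_on_of_nodup_map (isNaming_named hF (max k k')).nodup_snd h₁ h₂ rfl
  exact congrArg Prod.fst this

theorem exists_naming (D : Set ℕ) (hD : ∀ d, d ∈ D ↔ inD d = true) :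
    ∃ e : D ≃ BinString, ∀ d : D, ∃ k, ((d : ℕ), e d) ∈ named inD F τ k := by
  have h : ∀ d : D, ∃ w k, ((d : ℕ), w) ∈ named inD F τ k := fun d =>
    let ⟨k, w, hw⟩ := exists_name ((hD d).1 d.2)
    ⟨w, k, hw⟩
  choose e he using h
  refine ⟨Equiv.ofBijective e ⟨fun d d' hdd => ?_, fun w => ?_⟩, he⟩
  · obtain ⟨k, hk⟩ := he d
    obtain ⟨k', hk'⟩ := he d'
    exact Subtype.ext (named_snd_unique hF hk (hdd ▸ hk'))
  · obtain ⟨k, d, hd⟩ := exists_named (inD := inD) (F := F) (τ := τ) w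
    have hdD : d ∈ D := (hD d).2 ((isNaming_named hF k).dom _ hd)
    obtain ⟨k', hk'⟩ := he ⟨d, hdD⟩
    exact ⟨⟨d, hdD⟩, named_fst_unique hF hk' hd⟩

end

/-! ### Words of tuples -/

/-- The input word of a list of strings. -/
def listWord (L : List BinString) : List Letter := [Letter.d].intercalate (L.map word)

theorem listWord_cons_cons (w w' : BinString) (L : List BinString) :
    listWord (w :: w' :: L) = word w ++ Letter.d :: listWord (w' :: L) := by
  simp [listWord, List.intercalate_cons_cons]

theorem word_injective : Function.Injective word :=
  List.map_injective_iff.2 fun a b h => by cases a <;> cases b <;> simp_all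

theorem d_notMem_word (w : BinString) : Letter.d ∉ word w := by
  intro h
  obtain ⟨b, -, hb⟩ := List.mem_map.1 h
  cases b <;> simp at hb

/-- Splitting at `d`, which occurs in no name, recovers the list. The lists `[]` and `[[]]` have the
same word, hence the nonemptiness. -/
theorem listWord_injective {L L' : List BinString} (hL : L ≠ []) (hL' : L' ≠ [])
    (h : listWord L = listWord L') : L = L' := by
  have key : ∀ M : List BinString, M ≠ [] → (listWord M).splitOn Letter.d = M.map word := by
    intro M hM
    refine List.splitOn_intercalate _ ?_ (by simpa using hM)
    intro w hw
    obtain ⟨v, -, rfl⟩ := List.mem_map.1 hw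
    exact d_notMem_word v
  exact List.map_injective_iff.2 word_injective (by rw [← key L hL, h, key L' hL'])

theorem length_le_listWord {L : List BinString} {w : BinString} (h : w ∈ L) :
    w.length ≤ (listWord L).length := by
  induction L with
  | nil => simp at h
  | cons v L ih =>
    cases L with
    | nil =>
      obtain rfl : w = v := by simpa using h
      simp [listWord, word]
    | cons v' L =>
      rw [listWord_cons_cons]
      rcases List.mem_cons.1 h with rfl | h
      · simp [word]
      · have := ih h
        simp
        omega

theorem filter_isData_word (w : BinString) : (word w).filter isData = word w := by
  refine List.filter_eq_self.2 fun z hz => ?_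
  obtain ⟨b, -, rfl⟩ := List.mem_map.1 hz
  cases b <;> rfl

theorem filter_isData_listWord (L : List BinString) : (listWord L).filter isData = listWord L := by
  induction L with
  | nil => rfl
  | cons v L ih =>
    cases L with
    | nil => simpa [listWord] using filter_isData_word v
    | cons v' L =>
      rw [listWord_cons_cons, List.filter_append, filter_isData_word, List.filter_cons_of_pos rfl, ih]

theorem expandWord_reverse (n : ℕ) (w : List (Bool × Bool)) :
    expandWord n w.reverse = (expandWord n w).reverse := by
  have : List.reverse ∘ expandSym n = expandSym n := by
    funext s
    by_cases h : s = (true, true) <;> simp [expandSym, h]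
  rw [expandWord, List.flatMap_reverse, this, expandWord]

theorem expandWord_nameSymbols (t : ℕ) (e : Entry) :
    expandWord t (nameSymbols e.2) = word (settle t e).2 := by
  have h : ∀ s : List Bool, (s.map fun b => (b, false)).flatMap (expandSym t) = word s := by
    intro s
    induction s with
    | nil => rfl
    | cons b s ih => cases b <;> simp_all [expandSym, letterOf, word]
  obtain ⟨d, b, s⟩ := e
  cases b
  · simpa [nameSymbols, settle, expandWord] using h s
  · simp [nameSymbols, settle, expandWord, h, expandSym, word]

theorem expandWord_tupleSymbols (t : ℕ) (l : List Entry) :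
    expandWord t (tupleSymbols l) = (listWord ((l.map (settle t)).map Prod.snd)).reverse := by
  rw [tupleSymbols, expandWord_reverse]
  congr 1
  induction l with
  | nil => rfl
  | cons e l ih =>
    cases l with
    | nil => simpa [listWord] using expandWord_nameSymbols t e
    | cons e' l =>
      have h : expandWord t ((false, true) :: (nameSymbols e'.2 ++
          l.flatMap fun e => (false, true) :: nameSymbols e.2)) =
          Letter.d :: listWord (((e' :: l).map (settle t)).map Prod.snd) := by
        rw [← ih]; rfl
      rw [List.map_cons, List.map_cons, List.map_cons, List.map_cons, listWord_cons_cons,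
        ← List.map_cons (f := Prod.snd), ← List.map_cons (f := settle t), ← h,
        ← expandWord_nameSymbols, expandWord, expandWord, expandWord, ← List.flatMap_append]
      rfl

/-! ### The clocked machine decides the paths -/

section

variable {inD : ℕ → Bool} {R : List ℕ → Bool} {F : List ℕ → ℕ × ℕ} {τ : List Bool → ℕ}

theorem table_hist (k : ℕ) : table inD R F (hist τ k) = pathTable R (entriesAt inD F τ k) := by
  rw [table, count_true_hist]
  rfl

/-- The trichotomy behind the time bound: an entry is old, or has a block, or belongs to the one
element whose new name may be short. -/
theorem mem_entriesAt {k : ℕ} (t : ℕ) {e : Entry} (h : e ∈ entriesAt inD F τ k) :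
    settle t e ∈ named inD F τ k ∨ t ≤ (settle t e).2.length ∨
      e.1 = (F ((oldEntries inD k (named inD F τ k)).map Prod.fst)).2 := by
  rcases List.mem_cons.1 h with rfl | h
  · exact Or.inr (Or.inr rfl)
  rcases List.mem_cons.1 h with rfl | h
  · exact Or.inr (Or.inl (by simp [settle]))
  rcases mem_oldEntries.1 h with ⟨h₁, h₂⟩ | ⟨rfl, -⟩
  · exact Or.inl (by simpa [settle, h₁] using h₂)
  · exact Or.inr (Or.inl (by simp [settle]))

theorem eq_of_map_snd (hF : Chooses inD R F) {l l' : List (ℕ × List Bool)}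
    (hl : ∀ a ∈ l, ∃ k, a ∈ named inD F τ k) (hl' : ∀ a ∈ l', ∃ k, a ∈ named inD F τ k)
    (h : l.map Prod.snd = l'.map Prod.snd) : l = l' := by
  induction l generalizing l' with
  | nil => exact (List.map_eq_nil_iff.1 h.symm).symm
  | cons a l ih =>
    obtain ⟨b, l', rfl⟩ : ∃ b m, l' = b :: m := by
      cases l' with
      | nil => simp at h
      | cons b m => exact ⟨b, m, rfl⟩
    rw [List.map_cons, List.map_cons, List.cons.injEq] at h
    obtain ⟨k, hk⟩ := hl a (by simp)
    obtain ⟨k', hk'⟩ := hl' b (by simp)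
    obtain ⟨a₁, a₂⟩ := a
    obtain ⟨b₁, b₂⟩ := b
    obtain rfl : a₂ = b₂ := h.1
    rw [named_snd_unique hF hk hk', ih (fun a ha => hl a (List.mem_cons_of_mem _ ha))
      (fun a ha => hl' a (List.mem_cons_of_mem _ ha)) h.2]

theorem exists_stage {l : List (ℕ × List Bool)} (hl : ∀ a ∈ l, ∃ k, a ∈ named inD F τ k) :
    ∃ k, ∀ a ∈ l, a ∈ named inD F τ k := by
  induction l with
  | nil => exact ⟨0, by simp⟩
  | cons a l ih =>
    obtain ⟨k, hk⟩ := ih fun a ha => hl a (List.mem_cons_of_mem _ ha)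
    obtain ⟨k', hk'⟩ := hl a (by simp)
    refine ⟨max k k', fun b hb => ?_⟩
    rcases List.mem_cons.1 hb with rfl | hb
    exacts [mem_named_mono (le_max_right _ _) hk', mem_named_mono (le_max_left _ _) (hk b hb)]

/-- For a path, consider the first stage after which all its elements are named. One of them is new
there, and either its own name has a block or its companion chosen by `F` lies on the path and has
one. So the input has at least `t` letters, where `t` bounds the number of simulated steps to the
end of that stage. -/
theorem accepts_iff (hT : IsTree inD R) (hF : Chooses inD R F) {l : List (ℕ × List Bool)}
    (hne : l ≠ []) (hl : ∀ a ∈ l, ∃ k, a ∈ named inD F τ k) {n : ℕ}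
    (hn : (listWord (l.map Prod.snd)).length ≤ n) :
    Accepts (table inD R F) τ n [] (listWord (l.map Prod.snd)).reverse ↔
      R (l.map Prod.fst) = true := by
  constructor
  · rintro ⟨k, -, hk⟩
    obtain ⟨w, hw, hwl⟩ := List.mem_map.1 hk
    change w ∈ table inD R F (hist τ k) at hw
    change expandWord (hist τ (k + 1)).length w = _ at hwl
    rw [table_hist] at hw
    obtain ⟨l', -, hB, hR, rfl⟩ := mem_pathTable.1 hw
    rw [expandWord_tupleSymbols, List.reverse_inj] at hwl
    have hl'ne : l' ≠ [] := by
      rintro rfl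
      exact hT.ne_nil _ hR rfl
    have h := listWord_injective (by simpa using hl'ne) (by simpa using hne) hwl
    have h' := eq_of_map_snd hF (τ := τ) (fun a ha => ?_) hl h
    · rw [← h', settle_fst]
      exact hR
    · obtain ⟨e, he, rfl⟩ := List.mem_map.1 ha
      refine ⟨k + 1, ?_⟩
      rw [named_succ]
      exact List.mem_map_of_mem (hB e he)
  · intro hR
    classical
    have hex := exists_stage hl
    obtain ⟨k, hk⟩ : ∃ k, Nat.find hex = k + 1 := by
      refine Nat.exists_eq_succ_of_ne_zero fun h0 => ?_
      have h := Nat.find_spec hex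
      rw [h0] at h
      obtain ⟨a, ha⟩ := List.exists_mem_of_ne_nil l hne
      have := h a ha
      simp [named, hist, state] at this
    have hall := Nat.find_spec hex
    have hmin := Nat.find_min hex (m := k) (by omega)
    rw [hk] at hall
    push Not at hmin
    obtain ⟨a, hal, hak⟩ := hmin
    set t := (hist τ (k + 1)).length with ht
    have hentry : ∀ a ∈ l, ∃ e ∈ entriesAt inD F τ k, settle t e = a := by
      intro a ha
      have := hall a ha
      rw [named_succ] at this
      exact List.mem_map.1 this
    choose! f hf hft using hentry
    have hsettle : (l.map f).map (settle t) = l := by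
      rw [List.map_map]
      exact (List.map_congr_left hft).trans (List.map_id l)
    have hfst : (l.map f).map Prod.fst = l.map Prod.fst := by
      rw [← settle_fst t, hsettle]
    refine ⟨k, ?_, ?_⟩
    · change (hist τ (k + 1)).count false ≤ _
      suffices h : ∃ b ∈ l, t ≤ b.2.length by
        obtain ⟨b, hb, htb⟩ := h
        have h₁ : (hist τ (k + 1)).count false ≤ t := List.count_le_length
        have h₂ := length_le_listWord (List.mem_map_of_mem (f := Prod.snd) hb)
        omega
      rcases mem_entriesAt t (hf a hal) with h | h | h
      · rw [hft a hal] at h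
        exact absurd h hak
      · rw [hft a hal] at h
        exact ⟨a, hal, h⟩
      · have h₁ : (f a).1 = a.1 := congrArg Prod.fst (hft a hal)
        obtain ⟨b, hb, hbp⟩ := List.mem_map.1 ((hF ((oldEntries inD k (named inD F τ k)).map
          Prod.fst)).2.2.2.2.2 _ hR (by rw [← h, h₁]; exact List.mem_map_of_mem hal))
        refine ⟨b, hb, ?_⟩
        have hp : (b.1, List.replicate t true ++ [false]) ∈ named inD F τ (k + 1) := by
          rw [named_succ]
          refine List.mem_map.2 ⟨(b.1, true, [false]), ?_, rfl⟩
          rw [hbp]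
          exact List.mem_cons_of_mem _ List.mem_cons_self
        rw [named_fst_unique hF (hall b hb) hp]
        simp
    · refine List.mem_map.2 ⟨tupleSymbols (l.map f), ?_, ?_⟩
      · change _ ∈ table inD R F (hist τ k)
        rw [table_hist]
        refine mem_pathTable.2 ⟨_, ?_, ?_, by rw [hfst]; exact hR, rfl⟩
        · have hnd : ((l.map f).map Prod.fst).Nodup := by rw [hfst]; exact hT.nodup hR
          -- A path has no repetitions, so it is among the lists of length at most `B.length` that
          -- the table runs through.
          refine (List.subperm_of_subset (List.Nodup.of_map _ hnd) fun e he => ?_).length_le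
          obtain ⟨a, ha, rfl⟩ := List.mem_map.1 he
          exact hf a ha
        · intro e he
          obtain ⟨a, ha, rfl⟩ := List.mem_map.1 he
          exact hf a ha
      · change expandWord t _ = _
        rw [expandWord_tupleSymbols, hsettle]

end

open FirstOrder.Language.Structure

/-! ### From computable structures to the clocked machine -/

theorem exists_paths {D : Set ℕ} [sig.Structure D] (hc : IsComputable sig D)
    (hT : IsInjectiveOfUnboundedDepth D) :
    ∃ (inD : ℕ → Bool) (R : List ℕ → Bool), Computable inD ∧ Computable R ∧ IsTree inD R ∧
      (∀ d, d ∈ D ↔ inD d = true) ∧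
      ∀ (n : ℕ) (x : Fin (n + 1) → D), R (List.ofFn fun i => (x i : ℕ)) = true ↔ IsPath x := by
  obtain ⟨inD, hD, hDspec⟩ := ComputablePred.computable_iff.1 hc.domain
  obtain ⟨f, hf, hfspec⟩ := ComputablePred.computable_iff.1 hc.relations
  have hDs : ∀ d, d ∈ D ↔ inD d = true := fun d => iff_of_eq (congrFun hDspec d)
  have hR : ∀ l : List ℕ, f (l.length, l) = true ↔ ∃ (n : ℕ) (x : Fin (n + 1) → D),
      l = List.ofFn (fun i => (x i : ℕ)) ∧ IsPath x := by
    intro l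
    rw [← iff_of_eq (congrFun hfspec (l.length, l))]
    constructor
    · rintro ⟨_, ⟨n⟩, x, -, h₁, h₂⟩
      exact ⟨n, x, h₁, h₂⟩
    · rintro ⟨n, x, rfl, h⟩
      exact ⟨n + 1, Rel.path n, x, List.length_ofFn, rfl, h⟩
  have hofFn : ∀ {n k : ℕ} (x : Fin n → D) (y : Fin k → D),
      List.ofFn (fun i => (x i : ℕ)) = List.ofFn (fun i => (y i : ℕ)) ↔
        List.ofFn x = List.ofFn y := by
    intro n k x y
    have h : ∀ {n : ℕ} (x : Fin n → D),
        List.ofFn (fun i => (x i : ℕ)) = (List.ofFn x).map Subtype.val := fun x => by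
      rw [List.map_ofFn]; rfl
    rw [h x, h y]
    exact (List.map_injective_iff.2 Subtype.val_injective).eq_iff
  obtain ⟨hP, hI, hU⟩ := hT
  refine ⟨inD, fun l => f (l.length, l), hD,
    hf.comp (Computable.pair Computable.list_length Computable.id), ⟨?_, ?_, ?_, ?_, ?_⟩, hDs, ?_⟩
  · intro l hl a ha
    obtain ⟨n, x, rfl, -⟩ := (hR l).1 hl
    obtain ⟨i, rfl⟩ := (List.mem_ofFn' _ _).1 ha
    exact (hDs _).1 (x i).2
  · intro l hl
    obtain ⟨n, x, rfl, -⟩ := (hR l).1 hl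
    simp
  · intro l l' hl hne hpre
    obtain ⟨n, x, rfl, hx⟩ := (hR l).1 hl
    obtain ⟨m, hm⟩ : ∃ m, l'.length = m + 1 :=
      Nat.exists_eq_succ_of_ne_zero (by simpa using hne)
    have hle : m ≤ n := by
      have := hpre.length_le
      rw [List.length_ofFn] at this
      omega
    refine (hR l').2 ⟨m, _, ?_, hP.path_prefix n m hle x hx⟩
    refine List.ext_getElem (by simpa using hm) fun i h₁ h₂ => ?_
    rw [hpre.getElem h₁, List.getElem_ofFn, List.getElem_ofFn]
    rfl
  · intro l l' a hl hl'
    obtain ⟨n, x, hx, hpx⟩ := (hR _).1 hl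
    obtain ⟨k, y, hy, hpy⟩ := (hR _).1 hl'
    have hlast : ∀ {n : ℕ} (x : Fin (n + 1) → D) (l : List ℕ),
        l ++ [a] = List.ofFn (fun i => (x i : ℕ)) → (x (Fin.last n) : ℕ) = a := by
      intro n x l h
      rw [List.ofFn_succ', List.concat_eq_append] at h
      exact (List.singleton_inj.1 (List.append_inj' h rfl).2).symm
    have h := hI n k x y hpx hpy (Subtype.ext ((hlast x l hx).trans (hlast y l' hy).symm))
    rw [← hofFn, ← hx, ← hy] at h
    exact List.append_cancel_right h
  · intro n
    obtain ⟨x, hx⟩ := hU n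
    exact ⟨_, (hR _).2 ⟨n, x, rfl, hx⟩, by simp⟩
  · intro n x
    refine (hR _).trans ⟨?_, fun h => ⟨n, x, rfl, h⟩⟩
    rintro ⟨k, y, h, hy⟩
    rw [hofFn] at h
    obtain rfl : n = k := by simpa using congrArg List.length h
    rwa [List.ofFn_injective h]

theorem filter_isData_replicate {z : Letter} (hz : isData z = false) (n : ℕ) :
    (List.replicate n z).filter isData = [] := by
  simp [hz]

theorem tupleWord_eq_listWord {n : ℕ} (x : Fin n → BinString) :
    tupleWord x = listWord (List.ofFn x) := by
  rw [listWord, List.map_ofFn]; rfl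

theorem word_eq_listWord (w : BinString) : word w = listWord [w] := by
  simp [listWord]

/-- A function which does not change the encoding is computable in polynomial time. -/
theorem polyTime_of_eq {α β Γ : Type} [Fintype Γ] (ea : α → List Γ) (eb : β → List Γ) (f : α → β)
    (h : ∀ a, eb (f a) = ea a) : Nonempty (Turing.TM2ComputableInPolyTime ea eb f) :=
  ⟨{ tm := Turing.idComputer Γ
     inputAlphabet := Equiv.cast rfl
     outputAlphabet := Equiv.cast rfl
     time := 1
     outputsFun := fun a => by
      rw [h a]
      exact (Turing.idComputableInPolyTime ea).outputsFun a }⟩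

/-- The index letters can be discarded: the data letters determine the tuple, and the tables contain
paths of all lengths. A query about the constant becomes a query about one-element paths, as `R_1 =
{r}`. -/
theorem isFullyPTime_of_paths {D : Set ℕ} [sig.Structure D] (hP : IsPrefixTree D)
    {inD : ℕ → Bool} {R : List ℕ → Bool} (hD : Computable inD) (hR : Computable R)
    (hT : IsTree inD R) (hDs : ∀ d, d ∈ D ↔ inD d = true)
    (hRs : ∀ (n : ℕ) (x : Fin (n + 1) → D), R (List.ofFn fun i => (x i : ℕ)) = true ↔ IsPath x) :
    FullyPTimePresentable sig D := by
  obtain ⟨F, hFc, hF⟩ := exists_chooses hT hR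
  obtain ⟨c, τ, hcτ⟩ := exists_computes (table_computable hD hR hFc)
  obtain ⟨e, he⟩ := exists_naming (τ := τ) hF D hDs
  let _ : sig.Structure BinString := Equiv.inducedStructure e
  refine ⟨_, ⟨exists_polyTime hcτ _ _ ?_, polyTime_of_eq _ _ _ fun _ => rfl,
    polyTime_of_eq _ _ _ ?_⟩, ⟨Equiv.inducedStructureEquiv e⟩⟩
  · have key : ∀ (n : ℕ) (x : Fin (n + 1) → BinString) (ok : Bool) (N : ℕ),
        (listWord (List.ofFn x)).length ≤ N →
        (ok = true ↔ Accepts (table inD R F) τ N [] (listWord (List.ofFn x)).reverse) →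
        (ok = true ↔ IsPath (e.symm ∘ x)) := by
      intro n x ok N hN hok
      have hsnd : (List.ofFn fun i => ((e.symm (x i) : ℕ), x i)).map Prod.snd = List.ofFn x := by
        rw [List.map_ofFn]; rfl
      have hfst : (List.ofFn fun i => ((e.symm (x i) : ℕ), x i)).map Prod.fst =
          List.ofFn fun i => ((e.symm ∘ x) i : ℕ) := by
        rw [List.map_ofFn]; rfl
      have := accepts_iff (τ := τ) hT hF (l := List.ofFn fun i => ((e.symm (x i) : ℕ), x i))
        (n := N) (by simp) (fun a ha => ?_) (by rwa [hsnd])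
      · rw [hsnd, hfst, hRs] at this
        exact hok.trans this
      · obtain ⟨i, rfl⟩ := (List.mem_ofFn' _ _).1 ha
        simpa using he (e.symm (x i))
    rintro (⟨⟨n⟩, x⟩ | ⟨⟨⟩, x⟩ | ⟨⟨⟩, w⟩) ok hok
    · have hin : Query.input (Query.rel (L := sig) (Rel.path n) x) =
          List.replicate (n + 1) Letter.a ++ listWord (List.ofFn x) := by
        rw [← tupleWord_eq_listWord]; rfl
      rw [hin, List.filter_append, filter_isData_listWord, filter_isData_replicate rfl,
        List.nil_append] at hok
      have := key n x ok _ (by simp) hok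
      classical
      change [decide (IsPath (e.symm ∘ x))] = _
      cases ok <;> simpa using this
    · have hin : Query.input (Query.const (L := sig) Fun.root w) =
          List.replicate 1 Letter.c ++ listWord (List.ofFn ![w]) := by
        rw [List.ofFn_succ, List.ofFn_zero, Matrix.cons_val_zero, ← word_eq_listWord]; rfl
      rw [hin, List.filter_append, filter_isData_listWord, filter_isData_replicate rfl,
        List.nil_append] at hok
      have h := key 0 ![w] ok _ (by simp) hok
      rw [hP.path_one] at h
      have hroot : (e.symm ∘ ![w]) 0 = root D ↔ w = e (root D) := e.symm_apply_eq
      rw [hroot] at h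
      have : (funMap (L := sig) Fun.root default : BinString) = e (root D) := by
        change e (funMap (L := sig) Fun.root (e.symm ∘ default)) = e (root D)
        rw [root]
        congr 2
        exact Subsingleton.elim _ _
      classical
      change [decide (w = funMap (L := sig) Fun.root default)] = _
      rw [this]
      cases ok <;> simpa using h
  · rintro ⟨_, ⟨⟩⟩

end PrefixTree

theorem mainTheorem9 :
    PTimeAlgebra.PTimeRobust PrefixTree.sig PrefixTree.IsInjectiveOfUnboundedDepth := by
  intro D _ _ hc hT
  obtain ⟨inD, R, hD, hR, hTree, hDs, hRs⟩ := PrefixTree.exists_paths hc hT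
  exact PrefixTree.isFullyPTime_of_paths hT.1 hD hR hTree hDs hRs
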